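/- Let $(\bar M,\phi,\xi,\eta,g)$ be a Kenmotsu manifold: $\bar M$ is a smooth manifold with Riemannian metric $g$, Riemannian connection $\bar\nabla$, a smooth $(1,1)$-tensor field $\phi$, a smooth vector field $\xi$ and the $1$-form $\eta=g(\cdot,\xi)$, such that $\eta(\xi)=1$, $\phi\xi=0$, $\eta\circ\phi=0$, $\phi^2X=-X+\eta(X)\xi$, $g(\phi X,Y)=-g(X,\phi Y)$, $g(\phi X,\phi Y)=g(X,Y)-\eta(X)\eta(Y)$, $\bar\nabla_X\xi=X-\eta(X)\xi$ and $(\bar\nabla_X\phi)Y=g(\phi X,Y)\xi-\eta(Y)\phi X$ for all vector fields $X,Y$. Let $M=M_2\times_f M_T$ with $M_2=M_\perp\times M_\theta$ be a product of smooth manifolds, with a warped product metric $g_M=g_{M_2}+f^2g_{M_T}$, where $g_{M_2}$ and $g_{M_T}$ are Riemannian metrics on $M_2$ and $M_T$ and $f$ is a positive smooth function on $M_2$, and let $M$ be isometrically immersed in $\bar M$. For $X$ tangent to $M$ let $PX$ be the component of $\phi X$ tangent to $M$. Assume that $M$ is a skew CR-submanifold of order $1$ with slant angle the constant $\theta\in(0,\pi/2)$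 whose distributions are the tangent spaces of the factors, with $\xi$ tangent to $M_\perp$: at every point, the subspaces of $TM$ tangent to $M_\perp$, $M_\theta$, $M_T$ are, respectively, $\ker P^2$ (anti-invariant), $\ker(P^2+\cos^2\theta\, I)$ (slant) and $\ker(P^2+I)$ (invariant), and $\xi$ is, along $M$, tangent to $M_\perp$. Put $\dim M_T=2p$. Let $h$ be the second fundamental form of $M$ in $\bar M$, let $\|h\|^2=\sum_{i,j}g(h(e_i,e_j),h(e_i,e_j))$ for an orthonormal basis $(e_i)$ of the tangent space of $M$, and let $\nabla^\perp\ln f$ and $\nabla^\theta\ln f$ be the components of the gradient of $\ln f$ tangent to $M_\perp$ and to $M_\theta$. Then, at every point of $M$, $$\|h\|^2\ \ge\ 2p\left[\|\nabla^\perp\ln f\|^2-1+(\csc^2\theta+\cot^2\theta)\,\|\nabla^\theta\ln f\|^2\right].$$ If equality holds at every point of $M$, then $M$ is totally geodesic in $\bar M$ (that is, $h=0$), and every leaf $\{m\}\times M_T$, $m\in M_2$, is totally umbilical in $\bar M$ (its second fundamental form in $\bar M$ is the induced metric times a normal vector field). -/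

import Mathlib

open Bundle
open scoped Manifold ContDiff Topology InnerProductSpace

noncomputable section

namespace KenmotsuSkewCR

section General

variable {E : Type*} [NormedAddCommGroup E] [NormedSpace ℝ E] [FiniteDimensional ℝ E]
  {H : Type*} [TopologicalSpace H] {I : ModelWithCorners ℝ E H}
  {N : Type*} [TopologicalSpace N] [ChartedSpace H N]

instance finiteDimensional_tangentSpace (x : N) : FiniteDimensional ℝ (TangentSpace I x) :=
  inferInstanceAs (FiniteDimensional ℝ E)

variable [RiemannianBundle (fun x : N ↦ TangentSpace I x)]

/-- The gradient of a function on a Riemannian manifold: `g(grad u, X) = X u`. -/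
def grad (u : N → ℝ) (x : N) : TangentSpace I x :=
  haveI : CompleteSpace (TangentSpace I x) := FiniteDimensional.complete ℝ _
  (InnerProductSpace.toDual ℝ (TangentSpace I x)).symm (mvfderiv I u x)

/-- `D` is the Riemannian (Levi-Civita) connection of the metric: it is torsion free, and
`u g(Y, Z) = g(∇_u Y, Z) + g(Y, ∇_u Z)`. In Mathlib's convention `D Y x u` is `(∇_u Y)(x)`. -/
structure IsLeviCivita [IsManifold I ∞ N]
    (D : CovariantDerivative I E (TangentSpace I : N → Type _)) : Prop where
  metric : ∀ (Y Z : ∀ x : N, TangentSpace I x) (x : N),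
    MDifferentiableAt I (I.prod 𝓘(ℝ, E))
      (fun y ↦ Bundle.TotalSpace.mk' E (E := fun y : N ↦ TangentSpace I y) y (Y y)) x →
    MDifferentiableAt I (I.prod 𝓘(ℝ, E))
      (fun y ↦ Bundle.TotalSpace.mk' E (E := fun y : N ↦ TangentSpace I y) y (Z y)) x →
    ∀ u : TangentSpace I x,
      mvfderiv I (fun y ↦ ⟪Y y, Z y⟫_ℝ) x u = ⟪D Y x u, Z x⟫_ℝ + ⟪Y x, D Z x u⟫_ℝ
  torsion_free : D.torsion = 0

/-- An almost contact metric structure `(φ, ξ, η, g)` on a Riemannian manifold with metric `g`.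
The one-form `η` is `g(·, ξ)`. -/
structure AlmostContactMetric (I : ModelWithCorners ℝ E H) (N : Type*) [TopologicalSpace N]
    [ChartedSpace H N] [IsManifold I ∞ N] [RiemannianBundle (fun x : N ↦ TangentSpace I x)] where
  φ : ∀ x : N, TangentSpace I x →L[ℝ] TangentSpace I x
  ξ : ∀ x : N, TangentSpace I x
  η : ∀ x : N, TangentSpace I x →L[ℝ] ℝ
  smooth_φ : ContMDiff I (I.prod 𝓘(ℝ, E →L[ℝ] E)) ∞
    (fun x ↦ Bundle.TotalSpace.mk' (E →L[ℝ] E)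
      (E := fun x : N ↦ TangentSpace I x →L[ℝ] TangentSpace I x) x (φ x))
  smooth_ξ : ContMDiff I (I.prod 𝓘(ℝ, E)) ∞
    (fun x ↦ Bundle.TotalSpace.mk' E (E := fun x : N ↦ TangentSpace I x) x (ξ x))
  φ_ξ : ∀ x, φ x (ξ x) = 0
  η_φ : ∀ x u, η x (φ x u) = 0
  φ_φ : ∀ x u, φ x (φ x u) = -u + η x u • ξ x
  φ_skew : ∀ x u v, ⟪φ x u, v⟫_ℝ = -⟪u, φ x v⟫_ℝ
  η_eq : ∀ x u, η x u = ⟪u, ξ x⟫_ℝ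
  η_ξ : ∀ x, η x (ξ x) = 1
  φ_isometry : ∀ x u v, ⟪φ x u, φ x v⟫_ℝ = ⟪u, v⟫_ℝ - η x u * η x v

/-- The structure is Kenmotsu, `D` being the Riemannian connection: `∇_X ξ = X - η(X) ξ` and
`(∇_X φ) Y = ∇_X (φ Y) - φ (∇_X Y) = g(φ X, Y) ξ - η(Y) φ X`. -/
structure IsKenmotsu [IsManifold I ∞ N]
    (S : AlmostContactMetric I N)
    (D : CovariantDerivative I E (TangentSpace I : N → Type _)) : Prop where
  leviCivita : IsLeviCivita D
  nabla_ξ : ∀ (x : N) (u : TangentSpace I x), D S.ξ x u = u - S.η x u • S.ξ x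
  nabla_φ : ∀ (Y : ∀ x : N, TangentSpace I x) (x : N),
    MDifferentiableAt I (I.prod 𝓘(ℝ, E))
      (fun y ↦ Bundle.TotalSpace.mk' E (E := fun y : N ↦ TangentSpace I y) y (Y y)) x →
    ∀ u : TangentSpace I x,
      D (fun y ↦ S.φ y (Y y)) x u - S.φ x (D Y x u) =
        ⟪S.φ x u, Y x⟫_ℝ • S.ξ x - S.η x (Y x) • S.φ x u

end General

section Immersions

variable {E : Type*} [NormedAddCommGroup E] [NormedSpace ℝ E] [FiniteDimensional ℝ E]
  {H : Type*} [TopologicalSpace H] {I : ModelWithCorners ℝ E H}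
  {N : Type*} [TopologicalSpace N] [ChartedSpace H N] [IsManifold I ∞ N]
  [RiemannianBundle (fun x : N ↦ TangentSpace I x)]
  {E' : Type*} [NormedAddCommGroup E'] [NormedSpace ℝ E'] [FiniteDimensional ℝ E']
  {H' : Type*} [TopologicalSpace H'] {J : ModelWithCorners ℝ E' H'}
  {L : Type*} [TopologicalSpace L] [ChartedSpace H' L] [IsManifold J ∞ L]

/-- The covariant derivative `∇_u s` at `x` of a vector field `s` along a map `F : L → N`.
If `(eᵢ)` is the coordinate frame of `TN` near `F x` and `s = ∑ sⁱ (eᵢ ∘ F)`, it is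
`∑ u(sⁱ) eᵢ + ∑ sⁱ(x) ∇_{dF u} eᵢ`; here `t` is the trivialization of `TN` given by this frame. -/
def covAlong (D : CovariantDerivative I E (TangentSpace I : N → Type _)) (F : L → N)
    (s : ∀ y : L, TangentSpace I (F y)) (x : L) (u : TangentSpace J x) : TangentSpace I (F x) :=
  let t := trivializationAt E (TangentSpace I : N → Type _) (F x)
  t.symm (F x) (mvfderiv J (fun y ↦ (t ⟨F y, s y⟩).2) x u) +
    D (fun z ↦ t.symm z (t ⟨F x, s x⟩).2) (F x) (mfderiv J I F x u)

/-- The second fundamental form `h` of an immersion `F : L → N` by the Gauss formula: `h(u, v)` is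
the component of `∇_u (dF V)` orthogonal to `dF (T_x L)`, where `V` is a vector field on `L` with
`V x = v` (by tensoriality the choice of `V` does not matter). -/
def sff (D : CovariantDerivative I E (TangentSpace I : N → Type _)) (F : L → N) (x : L)
    (u v : TangentSpace J x) : TangentSpace I (F x) :=
  (LinearMap.range (mfderiv J I F x).toLinearMap)ᗮ.starProjection
    (covAlong D F (fun y ↦ mfderiv J I F y (FiberBundle.extend E' v y)) x u)

variable (J) in
/-- The immersed submanifold is totally geodesic: `h = 0`. -/
def IsTotallyGeodesic (D : CovariantDerivative I E (TangentSpace I : N → Type _)) (F : L → N) :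
    Prop :=
  ∀ (x : L) (u v : TangentSpace J x), sff D F x u v = 0

variable (J) in
/-- The immersed submanifold is totally umbilical: `h(u, v) = g(u, v) Z` for the induced metric `g`
and some vector `Z` at each point (taking traces, `Z` is the mean curvature vector as soon as the
dimension is positive). -/
def IsTotallyUmbilical (D : CovariantDerivative I E (TangentSpace I : N → Type _)) (F : L → N) :
    Prop :=
  ∀ x : L, ∃ Z : TangentSpace I (F x), ∀ u v : TangentSpace J x,
    sff D F x u v = ⟪mfderiv J I F x u, mfderiv J I F x v⟫_ℝ • Z

variable [RiemannianBundle (fun x : L ↦ TangentSpace J x)]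

/-- Isometric immersions between Riemannian manifolds. -/
structure IsIsometricImmersion (J : ModelWithCorners ℝ E' H') (I : ModelWithCorners ℝ E H)
    {N : Type*} [TopologicalSpace N] [ChartedSpace H N]
    [RiemannianBundle (fun x : N ↦ TangentSpace I x)]
    {L : Type*} [TopologicalSpace L] [ChartedSpace H' L]
    [RiemannianBundle (fun x : L ↦ TangentSpace J x)] (F : L → N) : Prop where
  smooth : ContMDiff J I ∞ F
  isometry : ∀ (x : L) (u v : TangentSpace J x),
    ⟪mfderiv J I F x u, mfderiv J I F x v⟫_ℝ = ⟪u, v⟫_ℝ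

variable (J) in
/-- `‖h‖² = ∑ g(h(eᵢ, eⱼ), h(eᵢ, eⱼ))` for an orthonormal basis `(eᵢ)` of `T_x L`. -/
def sffNormSq (D : CovariantDerivative I E (TangentSpace I : N → Type _)) (F : L → N) (x : L) : ℝ :=
  let e := stdOrthonormalBasis ℝ (TangentSpace J x)
  ∑ i, ∑ j, ‖sff D F x (e i) (e j)‖ ^ 2

/-- The tangential part `P` of `φ` on an isometrically immersed `L`: `P u` is the vector of `T_x L`
with `g(P u, v) = g(φ (dF u), dF v)` for all `v`, that is, `dF (P u)` is the orthogonal projection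
of `φ (dF u)` to `dF (T_x L)`. -/
def tangentialPhi (S : AlmostContactMetric I N) (F : L → N) (x : L) :
    TangentSpace J x →ₗ[ℝ] TangentSpace J x :=
  LinearMap.adjoint (mfderiv J I F x).toLinearMap ∘ₗ (S.φ (F x)).toLinearMap ∘ₗ
    (mfderiv J I F x).toLinearMap

/-- The subspace `𝒟^c_x = ker (P² + c² Id)` of `T_x L`. -/
def eigenDistribution (S : AlmostContactMetric I N) (F : L → N) (c : ℝ) (x : L) :
    Submodule ℝ (TangentSpace J x) :=
  LinearMap.ker (tangentialPhi (J := J) S F x ∘ₗ tangentialPhi S F x + c ^ 2 • LinearMap.id)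

end Immersions

section WarpedProducts

/-- The Riemannian metric of `N₁ × N₂` is a warped product metric `g₁ + f² g₂`, with `g₁`, `g₂`
Riemannian metrics on `N₁`, `N₂` and a positive smooth warping function `f` on `N₁`. -/
structure IsWarpedProduct
    {E₁ : Type*} [NormedAddCommGroup E₁] [NormedSpace ℝ E₁] {H₁ : Type*} [TopologicalSpace H₁]
    {E₂ : Type*} [NormedAddCommGroup E₂] [NormedSpace ℝ E₂] {H₂ : Type*} [TopologicalSpace H₂]
    (I₁ : ModelWithCorners ℝ E₁ H₁) (I₂ : ModelWithCorners ℝ E₂ H₂)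
    {N₁ : Type*} [TopologicalSpace N₁] [ChartedSpace H₁ N₁] [IsManifold I₁ ∞ N₁]
    {N₂ : Type*} [TopologicalSpace N₂] [ChartedSpace H₂ N₂] [IsManifold I₂ ∞ N₂]
    [RiemannianBundle (fun x : N₁ × N₂ ↦ TangentSpace (I₁.prod I₂) x)] (f : N₁ → ℝ) : Prop where
  smooth : ContMDiff I₁ 𝓘(ℝ, ℝ) ∞ f
  pos : ∀ a, 0 < f a
  metric : ∃ (g₁ : Bundle.ContMDiffRiemannianMetric I₁ ∞ E₁ (fun a : N₁ ↦ TangentSpace I₁ a))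
    (g₂ : Bundle.ContMDiffRiemannianMetric I₂ ∞ E₂ (fun b : N₂ ↦ TangentSpace I₂ b)),
    ∀ (x : N₁ × N₂) (u v : TangentSpace (I₁.prod I₂) x),
      ⟪u, v⟫_ℝ =
        g₁.inner x.1 (mfderiv (I₁.prod I₂) I₁ Prod.fst x u)
            (mfderiv (I₁.prod I₂) I₁ Prod.fst x v) +
          f x.1 ^ 2 * g₂.inner x.2 (mfderiv (I₁.prod I₂) I₂ Prod.snd x u)
            (mfderiv (I₁.prod I₂) I₂ Prod.snd x v)

end WarpedProducts

section SkewCR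

variable {E₁ : Type*} [NormedAddCommGroup E₁] [NormedSpace ℝ E₁] [FiniteDimensional ℝ E₁]
  {A : Type*} [TopologicalSpace A] [ChartedSpace E₁ A] [IsManifold 𝓘(ℝ, E₁) ∞ A]
  {E₂ : Type*} [NormedAddCommGroup E₂] [NormedSpace ℝ E₂] [FiniteDimensional ℝ E₂]
  {B : Type*} [TopologicalSpace B] [ChartedSpace E₂ B] [IsManifold 𝓘(ℝ, E₂) ∞ B]
  {E₃ : Type*} [NormedAddCommGroup E₃] [NormedSpace ℝ E₃] [FiniteDimensional ℝ E₃]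
  {C : Type*} [TopologicalSpace C] [ChartedSpace E₃ C] [IsManifold 𝓘(ℝ, E₃) ∞ C]

/-- The model of `(A × B) × C`. -/
abbrev model₃ (E₁ E₂ E₃ : Type*) [NormedAddCommGroup E₁] [NormedSpace ℝ E₁]
    [NormedAddCommGroup E₂] [NormedSpace ℝ E₂] [NormedAddCommGroup E₃] [NormedSpace ℝ E₃] :=
  (𝓘(ℝ, E₁).prod 𝓘(ℝ, E₂)).prod 𝓘(ℝ, E₃)

/-- Vectors at `x` tangent to the factor `A` of `(A × B) × C`. -/
def tangentFst (x : (A × B) × C) : Submodule ℝ (TangentSpace (model₃ E₁ E₂ E₃) x) :=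
  LinearMap.range
    (mfderiv 𝓘(ℝ, E₁) (model₃ E₁ E₂ E₃) (fun a : A ↦ ((a, x.1.2), x.2)) x.1.1).toLinearMap

/-- Vectors at `x` tangent to the factor `B` of `(A × B) × C`. -/
def tangentSnd (x : (A × B) × C) : Submodule ℝ (TangentSpace (model₃ E₁ E₂ E₃) x) :=
  LinearMap.range
    (mfderiv 𝓘(ℝ, E₂) (model₃ E₁ E₂ E₃) (fun b : B ↦ ((x.1.1, b), x.2)) x.1.2).toLinearMap

/-- Vectors at `x` tangent to the factor `C` of `(A × B) × C`. -/
def tangentTrd (x : (A × B) × C) : Submodule ℝ (TangentSpace (model₃ E₁ E₂ E₃) x) :=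
  LinearMap.range
    (mfderiv 𝓘(ℝ, E₃) (model₃ E₁ E₂ E₃) (fun c : C ↦ (x.1, c)) x.2).toLinearMap

variable {E : Type*} [NormedAddCommGroup E] [NormedSpace ℝ E] [FiniteDimensional ℝ E]
  {N : Type*} [TopologicalSpace N] [ChartedSpace E N] [IsManifold 𝓘(ℝ, E) ∞ N]
  [RiemannianBundle (fun y : N ↦ TangentSpace 𝓘(ℝ, E) y)]
  [RiemannianBundle (fun x : (A × B) × C ↦ TangentSpace (model₃ E₁ E₂ E₃) x)]

variable (E₁ E₂ E₃) in
/-- `F` immerses `M = (A × B) × C` isometrically in the almost contact metric manifold `N` as a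
warped product skew CR-submanifold `M₂ ×_f M_T` of order `1` with slant angle `θ`, where
`M₂ = M_⊥ × M_θ`, `M_⊥ = A`, `M_θ = B`, `M_T = C`, and the structure field `ξ` is tangent to `M_⊥`.
The tangent spaces of the anti-invariant factor `A`, the proper slant factor `B` and the invariant
factor `C` are the eigenspaces of `P²` for the eigenvalues `0`, `-cos² θ` and `-1`. -/
structure IsWarpedSkewCR (S : AlmostContactMetric 𝓘(ℝ, E) N) (F : (A × B) × C → N)
    (f : A × B → ℝ) (θ : ℝ) : Prop where
  immersion : IsIsometricImmersion (model₃ E₁ E₂ E₃) 𝓘(ℝ, E) F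
  warped : IsWarpedProduct (N₁ := A × B) (N₂ := C) (𝓘(ℝ, E₁).prod 𝓘(ℝ, E₂)) 𝓘(ℝ, E₃) f
  angle_pos : 0 < θ
  angle_lt : θ < Real.pi / 2
  anti_invariant : ∀ x, (tangentFst x : Submodule ℝ (TangentSpace (model₃ E₁ E₂ E₃) x)) =
    eigenDistribution S F 0 x
  slant : ∀ x, (tangentSnd x : Submodule ℝ (TangentSpace (model₃ E₁ E₂ E₃) x)) =
    eigenDistribution S F (Real.cos θ) x
  invariant : ∀ x, (tangentTrd x : Submodule ℝ (TangentSpace (model₃ E₁ E₂ E₃) x)) =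
    eigenDistribution S F 1 x
  ξ_tangent : ∀ x, ∃ u ∈ (tangentFst x : Submodule ℝ (TangentSpace (model₃ E₁ E₂ E₃) x)),
    mfderiv (model₃ E₁ E₂ E₃) 𝓘(ℝ, E) F x u = S.ξ (F x)

variable (E₁ E₂ E₃)

/-- The gradient of `ln f` on `(A × B) × C`. -/
def gradLog (f : A × B → ℝ) (x : (A × B) × C) : TangentSpace (model₃ E₁ E₂ E₃) x :=
  grad (fun y : (A × B) × C ↦ Real.log (f y.1)) x

/-- The component of the gradient of `ln f` along `M_⊥ = A`. -/
def gradLogPerp (f : A × B → ℝ) (x : (A × B) × C) : TangentSpace (model₃ E₁ E₂ E₃) x :=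
  (tangentFst x).starProjection (gradLog E₁ E₂ E₃ f x)

/-- The component of the gradient of `ln f` along `M_θ = B`. -/
def gradLogSlant (f : A × B → ℝ) (x : (A × B) × C) : TangentSpace (model₃ E₁ E₂ E₃) x :=
  (tangentSnd x).starProjection (gradLog E₁ E₂ E₃ f x)

end SkewCR

end KenmotsuSkewCR

end

/-! The lower bound is identically zero. If `M_T` has positive dimension, then `grad ln f = ξ` along
`M`; since `ξ` is a unit field tangent to `M_⊥` and orthogonal to `M_θ`, the bracket is `1 - 1 + 0`.
If `p = 0`, the factor `2p` vanishes (`bound_eq_zero`). Hence the inequality is `‖h‖² ≥ 0`, and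
equality everywhere means `h = 0`.

That `grad ln f = ξ` comes from a symmetry argument (`inner_covAlong_φ`, `mvfderiv_log_eq_η`). Let
`X`, `Y` be coordinate fields of the fibre and `Z` one of the base. The fibres are invariant, so
`g(φY, Z) = 0`. Differentiating along `X`, with the Kenmotsu equation for `∇φ` and the warped
product formula `g(∇_X Z, W) = Z(ln f) g(X, W)`, gives `g(∇_X Y, φZ) = g(φX, Y)(η(Z) - Z(ln f))`.
The left side is symmetric in `X`, `Y` and the right side is skew, so both vanish; if `Y` has the
value `φX` at the point, this reads `|X|² (η(Z) - Z(ln f)) = 0`.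

For the leaves (`isTotallyUmbilical_leaf`): when `h = 0`, `∇_X Y` is tangent to `M`, and by the same
warped product formula its part orthogonal to the fibre is `-g(X, Y) grad ln f = -g(X, Y) ξ`. So
each leaf is umbilical with normal vector `-ξ`.

No connection on `M` is introduced: all derivatives are taken in the ambient manifold by `covAlong`,
applied to the images `dF V` of coordinate fields. The calculus needed is that `covAlong` respects
the metric (`IsLeviCivita.mvfderiv_inner`), obeys the Kenmotsu equation (`IsKenmotsu.covAlong_φ`)
and is symmetric on coordinate fields (`covAlong_mapExtend_comm`). -/

noncomputable section

namespace KenmotsuSkewCR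

/-! ### Calculus of the covariant derivative of vector fields along a map -/

section Along

variable {E : Type*} [NormedAddCommGroup E] [NormedSpace ℝ E]
  {H : Type*} [TopologicalSpace H] {I : ModelWithCorners ℝ E H}
  {N : Type*} [TopologicalSpace N] [ChartedSpace H N] [IsManifold I ∞ N]
  {E' : Type*} [NormedAddCommGroup E'] [NormedSpace ℝ E']
  {H' : Type*} [TopologicalSpace H'] {J : ModelWithCorners ℝ E' H'}
  {L : Type*} [TopologicalSpace L] [ChartedSpace H' L]

/-- Differentiability at `x` of a vector field `s` along a map `F`. -/
def MDiffAlong (J : ModelWithCorners ℝ E' H') {L : Type*} [TopologicalSpace L] [ChartedSpace H' L]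
    {F : L → N} (s : ∀ y : L, TangentSpace I (F y)) (x : L) : Prop :=
  MDifferentiableAt J (I.prod 𝓘(ℝ, E))
    (fun y ↦ Bundle.TotalSpace.mk' E (E := fun z : N ↦ TangentSpace I z) (F y) (s y)) x

variable {D : CovariantDerivative I E (TangentSpace I : N → Type _)} {F : L → N} {x : L}
  {s s' : ∀ y : L, TangentSpace I (F y)}

lemma mdiffAlong_iff : MDiffAlong J s x ↔ MDifferentiableAt J I F x ∧
    MDifferentiableAt J 𝓘(ℝ, E)
      (fun y ↦ (trivializationAt E (TangentSpace I : N → Type _) (F x) ⟨F y, s y⟩).2) x :=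
  mdifferentiableAt_totalSpace _ _

lemma MDiffAlong.congr (hs : MDiffAlong J s x) (h : s' =ᶠ[𝓝 x] s) : MDiffAlong J s' x :=
  hs.congr_of_eventuallyEq (h.mono fun y hy ↦ by simp [hy])

lemma eventually_mem_baseSet (hF : ContinuousAt F x) :
    ∀ᶠ y in 𝓝 x, F y ∈ (trivializationAt E (TangentSpace I : N → Type _) (F x)).baseSet :=
  hF.eventually ((trivializationAt E (TangentSpace I : N → Type _) (F x)).open_baseSet.mem_nhds
    (FiberBundle.mem_baseSet_trivializationAt' (F x)))

lemma trivialization_add (t : Trivialization E (π E (TangentSpace I : N → Type _)))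
    [MemTrivializationAtlas t] {z : N} (hz : z ∈ t.baseSet) (v w : TangentSpace I z) :
    (t ⟨z, v + w⟩).2 = (t ⟨z, v⟩).2 + (t ⟨z, w⟩).2 :=
  (t.linear ℝ hz).map_add v w

lemma trivialization_smul (t : Trivialization E (π E (TangentSpace I : N → Type _)))
    [MemTrivializationAtlas t] {z : N} (hz : z ∈ t.baseSet) (a : ℝ) (v : TangentSpace I z) :
    (t ⟨z, a • v⟩).2 = a • (t ⟨z, v⟩).2 :=
  (t.linear ℝ hz).map_smul a v

lemma trivialization_symm_add (t : Trivialization E (π E (TangentSpace I : N → Type _)))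
    [MemTrivializationAtlas t] {z : N} (hz : z ∈ t.baseSet) (v w : E) :
    t.symm z (v + w) = t.symm z v + t.symm z w := by
  have h := (t.symmₗ ℝ z).map_add v w
  rwa [t.symmₗ_apply hz, t.symmₗ_apply hz, t.symmₗ_apply hz] at h

lemma trivialization_symm_smul (t : Trivialization E (π E (TangentSpace I : N → Type _)))
    [MemTrivializationAtlas t] {z : N} (hz : z ∈ t.baseSet) (a : ℝ) (v : E) :
    t.symm z (a • v) = a • t.symm z v := by
  have h := (t.symmₗ ℝ z).map_smul a v
  rwa [t.symmₗ_apply hz, t.symmₗ_apply hz] at h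

/-- `extend` freezes the components in the frame at `z`, so it is linear only where that frame is
defined; later uses pass to germs at `z`. -/
lemma extend_add {z y : N}
    (hy : y ∈ (trivializationAt E (TangentSpace I : N → Type _) z).baseSet)
    (v w : TangentSpace I z) : FiberBundle.extend E (v + w) y =
      FiberBundle.extend E v y + FiberBundle.extend E w y := by
  simp only [FiberBundle.extend]
  rw [trivialization_add _ (FiberBundle.mem_baseSet_trivializationAt' z),
    trivialization_symm_add _ hy]

lemma extend_smul {z y : N}
    (hy : y ∈ (trivializationAt E (TangentSpace I : N → Type _) z).baseSet) (a : ℝ)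
    (v : TangentSpace I z) : FiberBundle.extend E (a • v) y = a • FiberBundle.extend E v y := by
  simp only [FiberBundle.extend]
  rw [trivialization_smul _ (FiberBundle.mem_baseSet_trivializationAt' z),
    trivialization_symm_smul _ hy]

lemma eventually_mem_baseSet_self (z : N) :
    ∀ᶠ y in 𝓝 z, y ∈ (trivializationAt E (TangentSpace I : N → Type _) z).baseSet :=
  eventually_mem_baseSet (F := id) continuousAt_id

lemma mdiffAlong_extend (z : N) (v : TangentSpace I z) :
    MDiffAlong I (F := fun y : N ↦ y) (FiberBundle.extend E v) z :=
  FiberBundle.mdifferentiableAt_extend I E v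

lemma cov_congr {z : N} {Y Y' : ∀ z : N, TangentSpace I z} (hY : MDiffAlong I (F := fun y : N ↦ y) Y z)
    (h : Y' =ᶠ[𝓝 z] Y) : D Y' z = D Y z :=
  D.isCovariantDerivativeOnUniv.congr_of_eventuallyEq (hY.congr h) hY Filter.univ_mem h

lemma cov_extend_add (z : N) (v w : TangentSpace I z) :
    D (FiberBundle.extend E (v + w)) z =
      D (FiberBundle.extend E v) z + D (FiberBundle.extend E w) z := by
  rw [← D.isCovariantDerivativeOnUniv.add (mdiffAlong_extend z v) (mdiffAlong_extend z w)]
  refine (cov_congr (mdiffAlong_extend z (v + w)) ?_).symm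
  filter_upwards [eventually_mem_baseSet_self (I := I) z] with y hy
  exact (extend_add hy v w).symm

lemma cov_extend_smul (z : N) (a : ℝ) (v : TangentSpace I z) :
    D (FiberBundle.extend E (a • v)) z = a • D (FiberBundle.extend E v) z := by
  rw [← D.isCovariantDerivativeOnUniv.smul_const a (mdiffAlong_extend z v)]
  refine (cov_congr (mdiffAlong_extend z (a • v)) ?_).symm
  filter_upwards [eventually_mem_baseSet_self (I := I) z] with y hy
  exact (extend_smul hy a v).symm

lemma covAlong_def (u : TangentSpace J x) : covAlong D F s x u =
    (trivializationAt E (TangentSpace I : N → Type _) (F x)).symm (F x)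
      (mvfderiv J (fun y ↦ (trivializationAt E (TangentSpace I : N → Type _) (F x)
        ⟨F y, s y⟩).2) x u) + D (FiberBundle.extend E (s x)) (F x) (mfderiv J I F x u) := rfl

lemma trivialization_symm_apply (z : N) (v : TangentSpace I z) :
    (trivializationAt E (TangentSpace I : N → Type _) z).symm z
      (trivializationAt E (TangentSpace I : N → Type _) z ⟨z, v⟩).2 = v :=
  Trivialization.symm_apply_apply_mk _ (FiberBundle.mem_baseSet_trivializationAt' z) v

lemma mvfderiv_congr {V : Type*} [NormedAddCommGroup V] [NormedSpace ℝ V] {g g' : L → V}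
    (h : g =ᶠ[𝓝 x] g') : mvfderiv J g x = mvfderiv J g' x := by
  unfold mvfderiv
  ext v
  simp only [ContinuousLinearMap.comp_apply]
  rw [h.mfderiv_eq]
  rfl

lemma covAlong_congr (h : s' =ᶠ[𝓝 x] s) : covAlong (J := J) D F s' x = covAlong D F s x := by
  funext u
  rw [covAlong_def, covAlong_def, h.eq_of_nhds, mvfderiv_congr (g' := fun y ↦
    (trivializationAt E (TangentSpace I : N → Type _) (F x) ⟨F y, s y⟩).2)
    (h.mono fun y hy ↦ by simp only [hy])]

lemma MDiffAlong.add (hs : MDiffAlong J s x) (hs' : MDiffAlong J s' x) :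
    MDiffAlong J (s + s') x := by
  rw [mdiffAlong_iff] at *
  refine ⟨hs.1, (hs.2.add hs'.2).congr_of_eventuallyEq ?_⟩
  filter_upwards [eventually_mem_baseSet (I := I) hs.1.continuousAt] with y hy
  simp [trivialization_add _ hy]

lemma MDiffAlong.smul {c : L → ℝ} (hc : MDifferentiableAt J 𝓘(ℝ, ℝ) c x) (hs : MDiffAlong J s x) :
    MDiffAlong J (fun y ↦ c y • s y) x := by
  rw [mdiffAlong_iff] at *
  refine ⟨hs.1, (hc.smul hs.2).congr_of_eventuallyEq ?_⟩
  filter_upwards [eventually_mem_baseSet (I := I) hs.1.continuousAt] with y hy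
  simp [trivialization_smul _ hy]

lemma covAlong_add (hs : MDiffAlong J s x) (hs' : MDiffAlong J s' x) (u : TangentSpace J x) :
    covAlong D F (s + s') x u = covAlong D F s x u + covAlong D F s' x u := by
  rw [mdiffAlong_iff] at *
  have : (fun y ↦ (trivializationAt E (TangentSpace I : N → Type _) (F x) ⟨F y, (s + s') y⟩).2)
      =ᶠ[𝓝 x] (fun y ↦ (trivializationAt E (TangentSpace I : N → Type _) (F x) ⟨F y, s y⟩).2) +
        (fun y ↦ (trivializationAt E (TangentSpace I : N → Type _) (F x) ⟨F y, s' y⟩).2) := by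
    filter_upwards [eventually_mem_baseSet (I := I) hs.1.continuousAt] with y hy
    simp [trivialization_add _ hy]
  rw [covAlong_def, covAlong_def, covAlong_def, mvfderiv_congr this, mvfderiv_add hs.2 hs'.2,
    Pi.add_apply, cov_extend_add, add_apply, add_apply,
    trivialization_symm_add _ (FiberBundle.mem_baseSet_trivializationAt' (F x))]
  abel

/-- The Leibniz rule acts on the component term of `covAlong` only; the connection term sees just
the value `s x` and scales by `c x`. -/
lemma covAlong_smul {c : L → ℝ} (hc : MDifferentiableAt J 𝓘(ℝ, ℝ) c x) (hs : MDiffAlong J s x)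
    (u : TangentSpace J x) :
    covAlong D F (fun y ↦ c y • s y) x u = c x • covAlong D F s x u + mvfderiv J c x u • s x := by
  rw [mdiffAlong_iff] at *
  have : (fun y ↦ (trivializationAt E (TangentSpace I : N → Type _) (F x) ⟨F y, c y • s y⟩).2)
      =ᶠ[𝓝 x] c •
        (fun y ↦ (trivializationAt E (TangentSpace I : N → Type _) (F x) ⟨F y, s y⟩).2) := by
    filter_upwards [eventually_mem_baseSet (I := I) hs.1.continuousAt] with y hy
    simp [trivialization_smul _ hy]
  have hm := FiberBundle.mem_baseSet_trivializationAt' (F := E) (E := (TangentSpace I : N → Type _)) (F x)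
  rw [covAlong_def, covAlong_def, mvfderiv_congr this, mvfderiv_smul hc hs.2,
    cov_extend_smul, add_apply, trivialization_symm_add _ hm]
  simp only [smul_apply, ContinuousLinearMap.smulRight_apply,
    trivialization_symm_smul _ hm, trivialization_symm_apply]
  module

lemma trivialization_symm_zero (t : Trivialization E (π E (TangentSpace I : N → Type _)))
    [MemTrivializationAtlas t] {z : N} (hz : z ∈ t.baseSet) : t.symm z (0 : E) = 0 := by
  simpa using trivialization_symm_smul t hz 0 0

/-- The components of `extend E v` in the frame at `z` are constant, so only the connection term
survives. -/
lemma covAlong_id_extend (z : N) (v : TangentSpace I z) (u : TangentSpace I z) :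
    covAlong D (fun y : N ↦ y) (FiberBundle.extend E v) z u = D (FiberBundle.extend E v) z u := by
  have h : (fun y ↦ (trivializationAt E (TangentSpace I : N → Type _) z
      ⟨y, FiberBundle.extend E v y⟩).2) =ᶠ[𝓝 z]
      fun _ ↦ (trivializationAt E (TangentSpace I : N → Type _) z ⟨z, v⟩).2 := by
    filter_upwards [eventually_mem_baseSet_self (I := I) z] with y hy
    simp only [FiberBundle.extend]
    rw [Trivialization.apply_mk_symm _ hy]
  rw [covAlong_def, mvfderiv_congr h, mvfderiv_const, zero_apply,
    trivialization_symm_zero _ (FiberBundle.mem_baseSet_trivializationAt' z), zero_add,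
    FiberBundle.extend_apply_self]
  congr 1
  exact congr($(mfderiv_id) u)

/-- On vector fields of the manifold itself, `covAlong` is the connection. -/
lemma covAlong_id [FiniteDimensional ℝ E] {z : N} {Y : ∀ z : N, TangentSpace I z}
    (hY : MDiffAlong I (F := fun y : N ↦ y) Y z) (u : TangentSpace I z) :
    covAlong D (fun y : N ↦ y) Y z u = D Y z u := by
  -- Both sides satisfy the same Leibniz rule, so their difference depends only on the value of the
  -- field at `z` and may be tested on `extend E (Y z)`.
  have hT : TensorialAt I E (fun σ : ∀ z : N, TangentSpace I z ↦
      covAlong D (fun y : N ↦ y) σ z u - D σ z u) z := by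
    constructor
    · intro f σ hf hσ
      have h1 := covAlong_smul (D := D) (F := fun y : N ↦ y) hf hσ u
      have h2 := D.isCovariantDerivativeOnUniv.leibniz hσ hf
      have h3 : covAlong D (fun y : N ↦ y) (f • σ) z u =
          f z • covAlong D (fun y : N ↦ y) σ z u + mvfderiv I f z u • σ z := h1
      have h4 := congr($h2 u)
      simp only [add_apply, smul_apply, ContinuousLinearMap.smulRight_apply] at h4
      rw [h3]
      erw [h4]
      rw [smul_sub]
      abel
    · intro σ σ' hσ hσ'
      have h1 := covAlong_add (D := D) (F := fun y : N ↦ y) hσ hσ' u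
      have h4 := congr($(D.isCovariantDerivativeOnUniv.add hσ hσ') u)
      simp only [add_apply] at h4
      rw [h1]
      erw [h4]
      abel
  have := hT.pointwise hY (mdiffAlong_extend z (Y z)) (by simp)
  simp only [covAlong_id_extend, sub_self] at this
  exact sub_eq_zero.mp this

lemma MDiffAlong.comp {z : L} {Y : ∀ z : N, TangentSpace I z}
    (hY : MDiffAlong I (F := fun y : N ↦ y) Y (F z)) (hF : MDifferentiableAt J I F z) :
    MDiffAlong J (F := F) (fun y ↦ Y (F y)) z :=
  MDifferentiableAt.comp z hY hF

omit [IsManifold I ∞ N] in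
lemma mvfderiv_comp_apply {V : Type*} [NormedAddCommGroup V] [NormedSpace ℝ V] {g : N → V}
    (hg : MDifferentiableAt I 𝓘(ℝ, V) g (F x)) (hF : MDifferentiableAt J I F x)
    (u : TangentSpace J x) :
    mvfderiv J (fun y ↦ g (F y)) x u = mvfderiv I g (F x) (mfderiv J I F x u) :=
  congr($(mfderiv_comp x hg hF) u)

/-- The covariant derivative along `F` of the restriction of a vector field. -/
lemma covAlong_comp [FiniteDimensional ℝ E] {Y : ∀ z : N, TangentSpace I z}
    (hY : MDiffAlong I (F := fun y : N ↦ y) Y (F x)) (hF : MDifferentiableAt J I F x)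
    (u : TangentSpace J x) :
    covAlong D F (fun y ↦ Y (F y)) x u = D Y (F x) (mfderiv J I F x u) := by
  rw [← covAlong_id hY, covAlong_def, covAlong_def, mvfderiv_comp_apply (mdiffAlong_iff.1 hY).2 hF]
  congr 2
  exact congr($(mfderiv_id) _).symm

/-- Differentiable vector fields along `F` are locally generated by restrictions of differentiable
vector fields. -/
lemma MDiffAlong.induction [FiniteDimensional ℝ E] (P : (∀ y : L, TangentSpace I (F y)) → Prop)
    (congr : ∀ s s' : ∀ y : L, TangentSpace I (F y), s' =ᶠ[𝓝 x] s → P s → P s')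
    (add : ∀ s s', MDiffAlong J s x → MDiffAlong J s' x → P s → P s' → P (s + s'))
    (smul : ∀ (c : L → ℝ) s, MDifferentiableAt J 𝓘(ℝ, ℝ) c x → MDiffAlong J s x → P s →
      P (fun y ↦ c y • s y))
    (comp : ∀ Y : ∀ z : N, TangentSpace I z, MDiffAlong I (F := fun y : N ↦ y) Y (F x) →
      P (fun y ↦ Y (F y))) (hs : MDiffAlong J s x) : P s := by
  classical
  obtain ⟨hF, hloc⟩ := mdiffAlong_iff.1 hs
  set t := trivializationAt E (TangentSpace I : N → Type _) (F x) with ht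
  -- Near `x` the field is `∑ cᵢ (Yᵢ ∘ F)`, where `Yᵢ` is the coordinate frame of the target at `F
  -- x` and `cᵢ` are the components of `s` in it.
  let b := Module.finBasis ℝ E
  let Y : Fin (Module.finrank ℝ E) → ∀ z : N, TangentSpace I z := fun i z ↦ t.symm z (b i)
  let c : Fin (Module.finrank ℝ E) → L → ℝ := fun i y ↦
    (b.coord i).toContinuousLinearMap (t ⟨F y, s y⟩).2
  have hc : ∀ i, MDifferentiableAt J 𝓘(ℝ, ℝ) (c i) x := fun i ↦
    ((b.coord i).toContinuousLinearMap.mdifferentiableAt).comp x hloc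
  have hY : ∀ i, MDiffAlong I (F := fun y : N ↦ y) (Y i) (F x) := fun i ↦ by
    have := mdiffAlong_extend (F x) (t.symm (F x) (b i))
    refine this.congr ?_
    filter_upwards with z
    simp only [FiberBundle.extend, Y]
    rw [← ht, Trivialization.apply_mk_symm _ (FiberBundle.mem_baseSet_trivializationAt' (F x))]
  -- Differentiability is carried through the induction because `add` asks for it. The empty sum is
  -- the restriction of the zero field, so `comp` covers it.
  have key : ∀ S : Finset (Fin (Module.finrank ℝ E)),
      MDiffAlong J (F := F) (fun y ↦ ∑ i ∈ S, c i y • Y i (F y)) x ∧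
        P (fun y ↦ ∑ i ∈ S, c i y • Y i (F y)) := by
    intro S
    induction S using Finset.induction_on with
    | empty =>
      have h0 : MDiffAlong I (F := fun y : N ↦ y) (fun z : N ↦ (0 : TangentSpace I z)) (F x) :=
        mdifferentiableAt_zeroSection ..
      simpa using ⟨h0.comp hF, comp _ h0⟩
    | insert i S hi ih =>
      have e : (fun y ↦ ∑ j ∈ insert i S, c j y • Y j (F y)) =
          (fun y ↦ c i y • Y i (F y)) + fun y ↦ ∑ j ∈ S, c j y • Y j (F y) := by
        funext y
        simp [Finset.sum_insert hi]
      have h1 := ((hY i).comp hF).smul (hc i)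
      rw [e]
      exact ⟨h1.add ih.1, add _ _ h1 ih.1 (smul _ _ (hc i) ((hY i).comp hF) (comp _ (hY i))) ih.2⟩
  refine congr _ _ ?_ (key Finset.univ).2
  filter_upwards [eventually_mem_baseSet (I := I) hF.continuousAt] with y hy
  have h1 : ∑ i, c i y • Y i (F y) = t.symmₗ ℝ (F y) (∑ i, c i y • b i) := by
    rw [map_sum]
    exact Finset.sum_congr rfl fun i _ ↦ by rw [map_smul, t.symmₗ_apply hy]
  rw [h1, t.symmₗ_apply hy]
  have h2 : ∑ i, c i y • b i = (t ⟨F y, s y⟩).2 := b.sum_repr _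
  rw [h2, Trivialization.symm_apply_apply_mk _ hy]

/-! ### Compatibility with the metric and with `φ` along maps -/

section Metric

variable [RiemannianBundle (fun x : N ↦ TangentSpace I x)]
  [IsContMDiffRiemannianBundle I ∞ E (fun y : N ↦ TangentSpace I y)]

lemma MDiffAlong.inner (hs : MDiffAlong J s x) (hs' : MDiffAlong J s' x) :
    MDifferentiableAt J 𝓘(ℝ, ℝ) (fun y ↦ ⟪s y, s' y⟫_ℝ) x :=
  MDifferentiableAt.inner_bundle hs hs'

/-- A Riemannian connection is metric along maps. -/
lemma IsLeviCivita.mvfderiv_inner [FiniteDimensional ℝ E] (hD : IsLeviCivita D) (hs : MDiffAlong J s x)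
    (hs' : MDiffAlong J s' x) (u : TangentSpace J x) :
    mvfderiv J (fun y ↦ ⟪s y, s' y⟫_ℝ) x u =
      ⟪covAlong D F s x u, s' x⟫_ℝ + ⟪s x, covAlong D F s' x u⟫_ℝ := by
  have hF := (mdiffAlong_iff.1 hs).1
  refine hs.induction (fun s ↦ mvfderiv J (fun y ↦ ⟪s y, s' y⟫_ℝ) x u =
      ⟪covAlong D F s x u, s' x⟫_ℝ + ⟪s x, covAlong D F s' x u⟫_ℝ) ?_ ?_ ?_ ?_
  · intro s₁ s₂ h h1
    rw [mvfderiv_congr (g' := fun y ↦ ⟪s₁ y, s' y⟫_ℝ) (h.mono fun y hy ↦ by simp only [hy]),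
      covAlong_congr h, h.eq_of_nhds, h1]
  · intro s₁ s₂ h₁ h₂ e₁ e₂
    simp only [Pi.add_apply, inner_add_left, covAlong_add h₁ h₂]
    rw [mvfderiv_fun_add (h₁.inner hs') (h₂.inner hs'), add_apply, e₁, e₂]
    ring
  · intro c s₁ hc h₁ e₁
    simp only [inner_smul_left, inner_add_left, covAlong_smul hc h₁, RCLike.conj_to_real]
    rw [mvfderiv_fun_mul hc (h₁.inner hs'), add_apply, smul_apply, smul_apply, e₁]
    simp only [smul_eq_mul]
    ring
  -- The first field is now a restriction `Y ∘ F`; the same induction on the second field leaves two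
  -- restrictions, where the identity is that of the connection on `N`.
  intro Y hY
  have hYF := hY.comp hF
  refine hs'.induction (fun s' ↦ mvfderiv J (fun y ↦ ⟪Y (F y), s' y⟫_ℝ) x u =
      ⟪covAlong D F (fun y ↦ Y (F y)) x u, s' x⟫_ℝ + ⟪Y (F x), covAlong D F s' x u⟫_ℝ) ?_ ?_ ?_ ?_
  · intro s₁ s₂ h h1
    rw [mvfderiv_congr (g' := fun y ↦ ⟪Y (F y), s₁ y⟫_ℝ) (h.mono fun y hy ↦ by simp only [hy]),
      covAlong_congr h, h.eq_of_nhds, h1]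
  · intro s₁ s₂ h₁ h₂ e₁ e₂
    simp only [Pi.add_apply, inner_add_right, covAlong_add h₁ h₂]
    rw [mvfderiv_fun_add (hYF.inner h₁) (hYF.inner h₂), add_apply, e₁, e₂]
    ring
  · intro c s₁ hc h₁ e₁
    simp only [inner_smul_right, inner_add_right, covAlong_smul hc h₁]
    rw [mvfderiv_fun_mul hc (hYF.inner h₁), add_apply, smul_apply, smul_apply, e₁]
    simp only [smul_eq_mul]
    ring
  intro Z hZ
  have hYZ : MDifferentiableAt I 𝓘(ℝ, ℝ) (fun z ↦ ⟪Y z, Z z⟫_ℝ) (F x) :=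
    MDiffAlong.inner (F := fun y : N ↦ y) hY hZ
  rw [mvfderiv_comp_apply hYZ hF, hD.metric Y Z (F x) hY hZ,
    covAlong_comp hY hF, covAlong_comp hZ hF]

omit [IsContMDiffRiemannianBundle I ∞ E (fun y : N ↦ TangentSpace I y)] in
lemma AlmostContactMetric.mdiffAlong_φ (S : AlmostContactMetric I N) (hs : MDiffAlong J s x) :
    MDiffAlong J (F := F) (fun y ↦ S.φ (F y) (s y)) x := by
  have hF := (mdiffAlong_iff.1 hs).1
  have h : MDifferentiableAt J (I.prod 𝓘(ℝ, E →L[ℝ] E))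
      (fun y ↦ Bundle.TotalSpace.mk' (E →L[ℝ] E)
      (E := fun x : N ↦ TangentSpace I x →L[ℝ] TangentSpace I x) (F y) (S.φ (F y))) x :=
    ((S.smooth_φ (F x)).mdifferentiableAt (by simp)).comp x hF
  exact MDifferentiableAt.clm_bundle_apply (b := F) (ϕ := fun y ↦ S.φ (F y)) (v := s) h hs

omit [IsContMDiffRiemannianBundle I ∞ E (fun y : N ↦ TangentSpace I y)] in
/-- The Kenmotsu equation for `∇φ` along maps. -/
lemma IsKenmotsu.covAlong_φ [FiniteDimensional ℝ E] {S : AlmostContactMetric I N} (hS : IsKenmotsu S D)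
    (hs : MDiffAlong J s x) (u : TangentSpace J x) :
    covAlong D F (fun y ↦ S.φ (F y) (s y)) x u = S.φ (F x) (covAlong D F s x u) +
      (⟪S.φ (F x) (mfderiv J I F x u), s x⟫_ℝ • S.ξ (F x) -
        S.η (F x) (s x) • S.φ (F x) (mfderiv J I F x u)) := by
  have hF := (mdiffAlong_iff.1 hs).1
  refine hs.induction (fun s ↦ covAlong D F (fun y ↦ S.φ (F y) (s y)) x u =
    S.φ (F x) (covAlong D F s x u) + (⟪S.φ (F x) (mfderiv J I F x u), s x⟫_ℝ • S.ξ (F x) -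
        S.η (F x) (s x) • S.φ (F x) (mfderiv J I F x u))) ?_ ?_ ?_ ?_
  · intro s₁ s₂ h h1
    have h2 : (fun y ↦ S.φ (F y) (s₂ y)) =ᶠ[𝓝 x] fun y ↦ S.φ (F y) (s₁ y) :=
      h.mono fun y hy ↦ congrArg (S.φ (F y)) hy
    rw [covAlong_congr h2, covAlong_congr h, h.eq_of_nhds, h1]
  · intro s₁ s₂ h₁ h₂ e₁ e₂
    have h : (fun y ↦ S.φ (F y) ((s₁ + s₂) y)) =
        (fun y ↦ S.φ (F y) (s₁ y)) + fun y ↦ S.φ (F y) (s₂ y) := by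
      funext y
      simp
    rw [h, covAlong_add (S.mdiffAlong_φ h₁) (S.mdiffAlong_φ h₂), e₁, e₂, covAlong_add h₁ h₂]
    simp only [Pi.add_apply, map_add, inner_add_right]
    module
  · intro c s₁ hc h₁ e₁
    have h : (fun y ↦ S.φ (F y) (c y • s₁ y)) = fun y ↦ c y • S.φ (F y) (s₁ y) := by
      funext y
      simp
    rw [h, covAlong_smul hc (S.mdiffAlong_φ h₁), e₁, covAlong_smul hc h₁]
    simp only [map_add, map_smul, inner_smul_right, smul_eq_mul]
    module
  intro Y hY
  have hφ : MDiffAlong I (F := fun y : N ↦ y) (fun z ↦ S.φ z (Y z)) (F x) :=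
    S.mdiffAlong_φ (F := fun y : N ↦ y) hY
  rw [covAlong_comp hY hF, covAlong_comp hφ hF, ← hS.nabla_φ Y (F x) hY]
  abel

end Metric

end Along

/-! ### Coordinate vector fields and symmetry of second derivatives -/

section Coordinates

variable {E : Type*} [NormedAddCommGroup E] [NormedSpace ℝ E]
  {H : Type*} [TopologicalSpace H] {I : ModelWithCorners ℝ E H}
  {N : Type*} [TopologicalSpace N] [ChartedSpace H N] [IsManifold I ∞ N]
  {E' : Type*} [NormedAddCommGroup E'] [NormedSpace ℝ E']
  {H' : Type*} [TopologicalSpace H'] {J : ModelWithCorners ℝ E' H'}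
  {L : Type*} [TopologicalSpace L] [ChartedSpace H' L] [IsManifold J ∞ L]

lemma trivializationAt_snd {z y : N} (hy : y ∈ (chartAt H z).source) (w : TangentSpace I y) :
    (trivializationAt E (TangentSpace I : N → Type _) z ⟨y, w⟩).2 =
      mfderiv I 𝓘(ℝ, E) (extChartAt I z) y w := by
  refine Eq.trans ?_ congr($(TangentBundle.continuousLinearMapAt_trivializationAt hy) w)
  rw [Trivialization.continuousLinearMapAt_apply, Trivialization.linearMapAt_apply,
    if_pos (by simpa using hy)]

/-- In the chart at `z`, the vector field `extend E v` is constant. -/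
lemma mfderiv_extChartAt_extend {z y : N} (hy : y ∈ (chartAt H z).source) (v : TangentSpace I z) :
    mfderiv I 𝓘(ℝ, E) (extChartAt I z) y (FiberBundle.extend E v y) = v := by
  rw [← trivializationAt_snd hy]
  simp only [FiberBundle.extend]
  rw [Trivialization.apply_mk_symm _ (by simpa using hy), trivializationAt_snd (mem_chart_source H z),
    mfderiv_extChartAt_self]
  rfl

lemma eventually_mem_chart_source (z : N) : ∀ᶠ y in 𝓝 z, y ∈ (chartAt H z).source :=
  (chartAt H z).open_source.mem_nhds (mem_chart_source H z)

/-- Injectivity of the chart's differential lets coordinate fields be recognised by their constant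
chart expression. -/
lemma eq_extend_of_mfderiv_extChartAt {z y : N} (hy : y ∈ (chartAt H z).source)
    (v : TangentSpace I z) (w : TangentSpace I y)
    (h : mfderiv I 𝓘(ℝ, E) (extChartAt I z) y w = v) : w = FiberBundle.extend E v y :=
  (isInvertible_mfderiv_extChartAt (I := I) (x := z) (by simpa using hy)).injective
    (h.trans (mfderiv_extChartAt_extend hy v).symm)

/-- Coordinate vector fields commute. -/
lemma mlieBracket_extend (z : N) (v w : TangentSpace I z) :
    VectorField.mlieBracket I (FiberBundle.extend E v) (FiberBundle.extend E w) z = 0 := by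
  -- Pulled back to the chart, both fields are constant near the point, and constant fields have
  -- zero bracket.
  have key : ∀ v : TangentSpace I z, ∀ y ∈ (extChartAt I z).target,
      VectorField.mpullbackWithin 𝓘(ℝ, E) I (extChartAt I z).symm (FiberBundle.extend E v)
        (Set.range I) y = v := by
    intro v y hy
    rw [VectorField.mpullbackWithin_apply,
      ContinuousLinearMap.inverse_eq (mfderivWithin_extChartAt_symm_comp_mfderiv_extChartAt hy)
        (mfderiv_extChartAt_comp_mfderivWithin_extChartAt_symm hy)]
    exact mfderiv_extChartAt_extend (by simpa using (extChartAt I z).map_target hy) v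
  have hnear : ∀ᶠ y in 𝓝[Set.range I] (extChartAt I z z), y ∈ (extChartAt I z).target :=
    extChartAt_target_mem_nhdsWithin z
  have hs : (extChartAt I z).symm ⁻¹' Set.univ ∩ Set.range I = Set.range I := by simp
  have h0 : ∀ a b : E, VectorField.lieBracketWithin ℝ (fun _ : E ↦ a) (fun _ : E ↦ b)
      (Set.range I) (extChartAt I z z) = 0 := by
    intro a b
    simp [VectorField.lieBracketWithin]
  have h := Filter.EventuallyEq.lieBracketWithin_vectorField_eq (𝕜 := ℝ)
    (V₁ := VectorField.mpullbackWithin 𝓘(ℝ, E) I (extChartAt I z).symm (FiberBundle.extend E v)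
      (Set.range I))
    (V := fun _ : E ↦ (v : E)) (W := fun _ : E ↦ (w : E))
    (W₁ := VectorField.mpullbackWithin 𝓘(ℝ, E) I (extChartAt I z).symm (FiberBundle.extend E w)
      (Set.range I))
    (hnear.mono fun y hy ↦ key v y hy) (key v _ (mem_extChartAt_target z))
    (hnear.mono fun y hy ↦ key w y hy) (key w _ (mem_extChartAt_target z))
  rw [← VectorField.mlieBracketWithin_univ, VectorField.mlieBracketWithin_apply, hs]
  exact (congrArg _ (h.trans (h0 v w))).trans (map_zero _)

/-- Symmetry of the Christoffel symbols: zero torsion, and coordinate fields commute. -/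
lemma cov_extend_comm [FiniteDimensional ℝ E]
    {D : CovariantDerivative I E (TangentSpace I : N → Type _)} (hD : D.torsion = 0) (z : N)
    (v w : TangentSpace I z) :
    D (FiberBundle.extend E v) z w = D (FiberBundle.extend E w) z v := by
  have h := D.torsion_apply_eq_extend (x := z) w v
  rw [hD, mlieBracket_extend, FiberBundle.extend_apply_self, FiberBundle.extend_apply_self,
    sub_zero] at h
  exact (sub_eq_zero.mp h.symm)

lemma two_le_infty : (2 : WithTop ℕ∞) ≤ ∞ := by
  exact WithTop.coe_le_coe.2 (le_top : (2 : ℕ∞) ≤ ⊤)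

/-- The image under `dF` of the coordinate vector field `extend E' v`. -/
def mapExtend (I : ModelWithCorners ℝ E H) (F : L → N) {x : L} (v : TangentSpace J x) :
    ∀ y : L, TangentSpace I (F y) :=
  fun y ↦ mfderiv J I F y (FiberBundle.extend E' v y)

omit [IsManifold I ∞ N] in
lemma mapExtend_self (F : L → N) {x : L} (v : TangentSpace J x) :
    mapExtend I F v x = mfderiv J I F x v := by
  simp [mapExtend]

variable [J.Boundaryless] {F : L → N} {x : L}

/-- The coordinate expression of `dF V` for a coordinate vector field `V`. -/
lemma exists_coordinates_mapExtend (hF : ContMDiff J I ∞ F) (x : L) :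
    ∃ Φ : E' → E, ContDiffAt ℝ 2 Φ (extChartAt J x x) ∧ ∀ v : TangentSpace J x, ∀ᶠ y in 𝓝 x,
      (trivializationAt E (TangentSpace I : N → Type _) (F x)
        ⟨F y, mapExtend I F v y⟩).2 =
        fderiv ℝ Φ (extChartAt J x y) v := by
  -- The witness is `F` read in charts. Absence of boundary makes it differentiable on a full
  -- neighbourhood, so ordinary `fderiv` applies.
  refine ⟨extChartAt I (F x) ∘ F ∘ (extChartAt J x).symm, ?_, fun v ↦ ?_⟩
  all_goals
    have hΦ : ContDiffAt ℝ 2 (extChartAt I (F x) ∘ F ∘ (extChartAt J x).symm)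
        (extChartAt J x x) := by
      have := ((contMDiffAt_iff.1 (hF x)).2).of_le (m := 2) two_le_infty
      rwa [J.range_eq_univ, contDiffWithinAt_univ] at this
  · exact hΦ
  have h1 := (continuousAt_extChartAt (I := J) x).eventually (hΦ.eventually (by simp))
  have h2 : ∀ᶠ y in 𝓝 x, F y ∈ (chartAt H (F x)).source :=
    hF.continuous.continuousAt.eventually (eventually_mem_chart_source (F x))
  filter_upwards [h1, h2, eventually_mem_chart_source (H := H') x] with y hy hFy hxy
  rw [mapExtend, trivializationAt_snd hFy]
  have e : (extChartAt I (F x) ∘ F ∘ (extChartAt J x).symm) ∘ extChartAt J x =ᶠ[𝓝 y]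
      extChartAt I (F x) ∘ F := by
    filter_upwards [(chartAt H' x).open_source.mem_nhds hxy] with z hz
    simp only [Function.comp_apply]
    rw [(extChartAt J x).left_inv (by simpa using hz)]
  have d1 := (hy.differentiableAt (by simp)).hasFDerivAt.hasMFDerivAt.comp y
    (mdifferentiableAt_extChartAt (I := J) hxy).hasMFDerivAt
  have d2 := (mdifferentiableAt_extChartAt (I := I) hFy).hasMFDerivAt.comp y
    ((hF y).mdifferentiableAt (by simp)).hasMFDerivAt
  have d := congr($((d1.congr_of_eventuallyEq e.symm).mfderiv.symm.trans d2.mfderiv)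
    (FiberBundle.extend E' v y))
  refine d.symm.trans ?_
  exact congrArg (fderiv ℝ _ _) (mfderiv_extChartAt_extend hxy v)

omit [J.Boundaryless] in
lemma mvfderiv_comp_extChartAt {g : E' → E} (hg : DifferentiableAt ℝ g (extChartAt J x x))
    (u : TangentSpace J x) :
    mvfderiv J (fun y ↦ g (extChartAt J x y)) x u = fderiv ℝ g (extChartAt J x x) u := by
  rw [mvfderiv_comp_apply (I := 𝓘(ℝ, E')) (F := extChartAt J x) hg.mdifferentiableAt
    (mdifferentiableAt_extChartAt (mem_chart_source H' x)), mfderiv_extChartAt_self]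
  have h : mfderiv 𝓘(ℝ, E') 𝓘(ℝ, E) g (extChartAt J x x) = fderiv ℝ g (extChartAt J x x) :=
    mfderiv_eq_fderiv
  exact DFunLike.congr_fun h u

/-- The image under `dF` of a coordinate vector field is differentiable along `F`. -/
lemma mdiffAlong_mapExtend (hF : ContMDiff J I ∞ F) (v : TangentSpace J x) :
    MDiffAlong J (mapExtend I F v) x := by
  obtain ⟨Φ, hΦ, h⟩ := exists_coordinates_mapExtend hF x
  rw [mdiffAlong_iff]
  refine ⟨(hF x).mdifferentiableAt (by simp), MDifferentiableAt.congr_of_eventuallyEq ?_ (h v)⟩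
  have hd : ∀ w : E', DifferentiableAt ℝ (fun z ↦ fderiv ℝ Φ z w) (extChartAt J x x) := fun w ↦
    ((hΦ.fderiv_right (m := 1) (by norm_num)).differentiableAt (by simp)).clm_apply
      (differentiableAt_const w)
  exact (hd v).mdifferentiableAt.comp x (mdifferentiableAt_extChartAt (mem_chart_source H' x))

/-- Symmetry of `∇_u (dF V)` for coordinate vector fields. -/
lemma covAlong_mapExtend_comm [FiniteDimensional ℝ E]
    {D : CovariantDerivative I E (TangentSpace I : N → Type _)} (hD : D.torsion = 0)
    (hF : ContMDiff J I ∞ F) (u v : TangentSpace J x) :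
    covAlong D F (mapExtend I F v) x u =
      covAlong D F (mapExtend I F u) x v := by
  obtain ⟨Φ, hΦ, h⟩ := exists_coordinates_mapExtend hF x
  have hd1 : DifferentiableAt ℝ (fderiv ℝ Φ) (extChartAt J x x) :=
    (hΦ.fderiv_right (m := 1) (by norm_num)).differentiableAt (by simp)
  have hd : ∀ v : E', DifferentiableAt ℝ (fun z ↦ fderiv ℝ Φ z v) (extChartAt J x x) := fun v ↦
    hd1.clm_apply (differentiableAt_const v)
  have h2 : ∀ u v : E', fderiv ℝ (fun z ↦ fderiv ℝ Φ z v) (extChartAt J x x) u =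
      fderiv ℝ (fderiv ℝ Φ) (extChartAt J x x) u v := by
    intro u v
    rw [fderiv_clm_apply hd1 (differentiableAt_const v)]
    simp
  have hsymm := hΦ.isSymmSndFDerivAt (by simp)
  rw [covAlong_def, covAlong_def, mvfderiv_congr (h v), mvfderiv_congr (h u),
    mvfderiv_comp_extChartAt (hd v), mvfderiv_comp_extChartAt (hd u), mapExtend_self, mapExtend_self,
    cov_extend_comm hD]
  congr 2
  -- The connection terms already agree by `cov_extend_comm`; what remains is the symmetry of the
  -- second derivative of `Φ`.
  exact (h2 u v).trans ((hsymm u v).trans (h2 v u).symm)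

end Coordinates

/-! ### Coordinate fields on products -/

section Products

variable {E : Type*} [NormedAddCommGroup E] [NormedSpace ℝ E]
  {H : Type*} [TopologicalSpace H] {I : ModelWithCorners ℝ E H}
  {N : Type*} [TopologicalSpace N] [ChartedSpace H N] [IsManifold I ∞ N]
  {E' : Type*} [NormedAddCommGroup E'] [NormedSpace ℝ E']
  {H' : Type*} [TopologicalSpace H'] {J : ModelWithCorners ℝ E' H'}
  {L : Type*} [TopologicalSpace L] [ChartedSpace H' L] [IsManifold J ∞ L]

/-- Coordinate vector fields of a product. -/
lemma extend_prod {x y : N × L} (h₁ : y.1 ∈ (chartAt H x.1).source)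
    (h₂ : y.2 ∈ (chartAt H' x.2).source) (v : TangentSpace I x.1) (w : TangentSpace J x.2) :
    FiberBundle.extend (E × E') (x := x) (E := (TangentSpace (I.prod J) : N × L → Type _)) (v, w) y =
      (FiberBundle.extend E v y.1, FiberBundle.extend E' w y.2) := by
  refine (eq_extend_of_mfderiv_extChartAt (I := I.prod J) (z := x) (by simp [h₁, h₂]) (v, w)
    (FiberBundle.extend E v y.1, FiberBundle.extend E' w y.2) ?_).symm
  have e : (extChartAt (I.prod J) x : N × L → E × E') =
      Prod.map (extChartAt I x.1) (extChartAt J x.2) := by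
    rw [extChartAt_prod]
    rfl
  have h := mfderiv_prodMap (p := y) (mdifferentiableAt_extChartAt (I := I) h₁)
    (mdifferentiableAt_extChartAt (I := J) h₂)
  -- The chart takes values in `E × E'` with its own model, while `mfderiv_prodMap` uses the product
  -- of two models; these agree after rewriting.
  have h' : mfderiv (I.prod J) 𝓘(ℝ, E × E') (extChartAt (I.prod J) x) y =
      mfderiv (I.prod J) (𝓘(ℝ, E).prod 𝓘(ℝ, E'))
        (Prod.map (extChartAt I x.1) (extChartAt J x.2)) y := by
    rw [e, ← modelWithCornersSelf_prod, ← chartedSpaceSelf_prod]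
  rw [h', h]
  exact Prod.ext (mfderiv_extChartAt_extend h₁ v) (mfderiv_extChartAt_extend h₂ w)

end Products

/-! ### Bilinearity and vanishing of the second fundamental form -/

section Sff

variable {E : Type*} [NormedAddCommGroup E] [NormedSpace ℝ E] [FiniteDimensional ℝ E]
  {H : Type*} [TopologicalSpace H] {I : ModelWithCorners ℝ E H}
  {N : Type*} [TopologicalSpace N] [ChartedSpace H N] [IsManifold I ∞ N]
  {E' : Type*} [NormedAddCommGroup E'] [NormedSpace ℝ E']
  {H' : Type*} [TopologicalSpace H'] {J : ModelWithCorners ℝ E' H'}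
  {L : Type*} [TopologicalSpace L] [ChartedSpace H' L]
  {D : CovariantDerivative I E (TangentSpace I : N → Type _)} {F : L → N} {x : L}

omit [FiniteDimensional ℝ E] in
lemma covAlong_add_dir (s : ∀ y : L, TangentSpace I (F y)) (u v : TangentSpace J x) :
    covAlong D F s x (u + v) = covAlong D F s x u + covAlong D F s x v := by
  simp only [covAlong_def, map_add]
  rw [
    trivialization_symm_add _ (FiberBundle.mem_baseSet_trivializationAt' (F x))]
  abel

omit [FiniteDimensional ℝ E] in
lemma covAlong_smul_dir (s : ∀ y : L, TangentSpace I (F y)) (a : ℝ) (u : TangentSpace J x) :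
    covAlong D F s x (a • u) = a • covAlong D F s x u := by
  simp only [covAlong_def, map_smul]
  rw [trivialization_symm_smul _ (FiberBundle.mem_baseSet_trivializationAt' (F x)), smul_add]

omit [FiniteDimensional ℝ E] in
/-- `covAlong` and precomposition. -/
lemma covAlong_precomp {E'' : Type*} [NormedAddCommGroup E''] [NormedSpace ℝ E'']
    {H'' : Type*} [TopologicalSpace H''] {K : ModelWithCorners ℝ E'' H''}
    {Q : Type*} [TopologicalSpace Q] [ChartedSpace H'' Q] {ι : Q → L} {q : Q}
    {s : ∀ y : L, TangentSpace I (F y)} (hs : MDiffAlong J s (ι q))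
    (hι : MDifferentiableAt K J ι q) (u : TangentSpace K q) :
    covAlong D (fun y ↦ F (ι y)) (fun y ↦ s (ι y)) q u = covAlong D F s (ι q) (mfderiv K J ι q u) := by
  obtain ⟨hF, hloc⟩ := mdiffAlong_iff.1 hs
  rw [covAlong_def, covAlong_def, mvfderiv_comp_apply hloc hι]
  congr 2
  exact congr($(mfderiv_comp q hF hι) u)

variable [IsManifold J ∞ L]

omit [FiniteDimensional ℝ E] [IsManifold I ∞ N] in
lemma mapExtend_add (u v : TangentSpace J x) :
    mapExtend I F (u + v) =ᶠ[𝓝 x] mapExtend I F u + mapExtend I F v := by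
  filter_upwards [eventually_mem_baseSet_self (I := J) x] with y hy
  simp only [mapExtend, extend_add hy, map_add]
  rfl

omit [FiniteDimensional ℝ E] [IsManifold I ∞ N] in
lemma mapExtend_smul (a : ℝ) (v : TangentSpace J x) :
    mapExtend I F (a • v) =ᶠ[𝓝 x] fun y ↦ a • mapExtend I F v y := by
  filter_upwards [eventually_mem_baseSet_self (I := J) x] with y hy
  simp only [mapExtend, extend_smul hy, map_smul]
  rfl

variable [RiemannianBundle (fun x : N ↦ TangentSpace I x)] [J.Boundaryless]

/-- The second fundamental form as a bilinear map. -/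
def sffBilin [FiniteDimensional ℝ E']
    (D : CovariantDerivative I E (TangentSpace I : N → Type _)) (hF : ContMDiff J I ∞ F)
    (x : L) : TangentSpace J x →ₗ[ℝ] TangentSpace J x →ₗ[ℝ] TangentSpace I (F x) :=
  LinearMap.mk₂ ℝ (fun u v ↦ sff D F x u v)
    (fun u v w ↦ by simp only [sff, covAlong_add_dir, map_add])
    (fun a u v ↦ by simp only [sff, covAlong_smul_dir, map_smul])
    -- In the second argument `mapExtend` is additive only as a germ, which suffices for `covAlong`.
    (fun u v w ↦ by
      have h := congrFun (covAlong_congr (D := D) (mapExtend_add (I := I) (F := F) v w)) u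
      rw [covAlong_add (mdiffAlong_mapExtend hF v) (mdiffAlong_mapExtend hF w)] at h
      exact (congrArg _ h).trans (map_add _ _ _))
    (fun a u v ↦ by
      have h := congrFun (covAlong_congr (D := D) (mapExtend_smul (I := I) (F := F) a v)) u
      rw [covAlong_smul mdifferentiableAt_const (mdiffAlong_mapExtend hF v), mvfderiv_const,
        zero_apply, zero_smul, add_zero] at h
      exact (congrArg _ h).trans (map_smul _ _ _))

omit [FiniteDimensional ℝ E] in
/-- The second fundamental form vanishes where its norm does. -/
lemma sff_eq_zero_of_sffNormSq_eq_zero [FiniteDimensional ℝ E']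
    [RiemannianBundle (fun x : L ↦ TangentSpace J x)]
    (hF : ContMDiff J I ∞ F) (h : sffNormSq J D F x = 0) (u v : TangentSpace J x) :
    sff D F x u v = 0 := by
  have h1 : ∀ i j, sff D F x (stdOrthonormalBasis ℝ (TangentSpace J x) i)
      (stdOrthonormalBasis ℝ (TangentSpace J x) j) = 0 := by
    intro i j
    have h2 := (Finset.sum_eq_zero_iff_of_nonneg
      (fun i _ ↦ Finset.sum_nonneg fun j _ ↦ sq_nonneg _)).1 h i (Finset.mem_univ i)
    have h3 := (Finset.sum_eq_zero_iff_of_nonneg (fun j _ ↦ sq_nonneg _)).1 h2 j (Finset.mem_univ j)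
    simpa using h3
  have h2 : sffBilin D hF x = 0 := by
    refine LinearMap.ext_basis (stdOrthonormalBasis ℝ (TangentSpace J x)).toBasis
      (stdOrthonormalBasis ℝ (TangentSpace J x)).toBasis fun i j ↦ ?_
    simpa only [OrthonormalBasis.coe_toBasis] using! h1 i j
  exact LinearMap.congr_fun₂ h2 u v

omit [FiniteDimensional ℝ E] [J.Boundaryless] in
lemma sffNormSq_nonneg [FiniteDimensional ℝ E'] [RiemannianBundle (fun x : L ↦ TangentSpace J x)] :
    0 ≤ sffNormSq J D F x :=
  Finset.sum_nonneg fun _ _ ↦ Finset.sum_nonneg fun _ _ ↦ sq_nonneg _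

end Sff

/-! ### Warped products: horizontal and vertical fields, derivative of the fibre metric -/

section Warped

variable {E₁ : Type*} [NormedAddCommGroup E₁] [NormedSpace ℝ E₁]
  {H₁ : Type*} [TopologicalSpace H₁] {I₁ : ModelWithCorners ℝ E₁ H₁}
  {N₁ : Type*} [TopologicalSpace N₁] [ChartedSpace H₁ N₁] [IsManifold I₁ ∞ N₁]
  {E₂ : Type*} [NormedAddCommGroup E₂] [NormedSpace ℝ E₂]
  {H₂ : Type*} [TopologicalSpace H₂] {I₂ : ModelWithCorners ℝ E₂ H₂}
  {N₂ : Type*} [TopologicalSpace N₂] [ChartedSpace H₂ N₂] [IsManifold I₂ ∞ N₂]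

/-- Vectors tangent to the first factor of a product. -/
def horizontal (x : N₁ × N₂) (z : TangentSpace I₁ x.1) : TangentSpace (I₁.prod I₂) x := (z, 0)

/-- Vectors tangent to the second factor of a product. -/
def vertical (x : N₁ × N₂) (w : TangentSpace I₂ x.2) : TangentSpace (I₁.prod I₂) x := (0, w)

omit [IsManifold I₁ ∞ N₁] [IsManifold I₂ ∞ N₂] in
lemma horizontal_add_vertical (x : N₁ × N₂) (u : TangentSpace (I₁.prod I₂) x) :
    horizontal (I₁ := I₁) (I₂ := I₂) x u.1 + vertical x u.2 = u :=
  Prod.ext (add_zero _) (zero_add _)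

omit [IsManifold I₁ ∞ N₁] [IsManifold I₂ ∞ N₂] in
lemma mfderiv_mk_left (x : N₁ × N₂) (z : TangentSpace I₁ x.1) :
    mfderiv I₁ (I₁.prod I₂) (fun a : N₁ ↦ (a, x.2)) x.1 z = horizontal x z :=
  congr($(mfderiv_prod_left) z)

omit [IsManifold I₁ ∞ N₁] [IsManifold I₂ ∞ N₂] in
lemma mfderiv_mk_right (x : N₁ × N₂) (w : TangentSpace I₂ x.2) :
    mfderiv I₂ (I₁.prod I₂) (fun b : N₂ ↦ (x.1, b)) x.2 w = vertical x w :=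
  congr($(mfderiv_prod_right) w)

lemma extend_zero {x y : N₁} (hy : y ∈ (chartAt H₁ x).source) :
    FiberBundle.extend E₁ (0 : TangentSpace I₁ x) y = 0 := by
  simpa using extend_smul (I := I₁) (z := x) (y := y) hy 0 0

lemma extend_horizontal {x y : N₁ × N₂} (h₁ : y.1 ∈ (chartAt H₁ x.1).source)
    (h₂ : y.2 ∈ (chartAt H₂ x.2).source) (z : TangentSpace I₁ x.1) :
    FiberBundle.extend (E₁ × E₂) (horizontal (I₁ := I₁) (I₂ := I₂) x z) y =
      horizontal y (FiberBundle.extend E₁ z y.1) :=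
  (extend_prod h₁ h₂ z 0).trans (congrArg (Prod.mk _) (extend_zero h₂))

lemma extend_vertical {x y : N₁ × N₂} (h₁ : y.1 ∈ (chartAt H₁ x.1).source)
    (h₂ : y.2 ∈ (chartAt H₂ x.2).source) (w : TangentSpace I₂ x.2) :
    FiberBundle.extend (E₁ × E₂) (vertical (I₁ := I₁) (I₂ := I₂) x w) y =
      vertical y (FiberBundle.extend E₂ w y.2) :=
  (extend_prod h₁ h₂ 0 w).trans (congrArg (fun z ↦ Prod.mk z _) (extend_zero h₁))

omit [IsManifold I₁ ∞ N₁] [IsManifold I₂ ∞ N₂] in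
lemma eventually_mem_chart_source_prod (x : N₁ × N₂) : ∀ᶠ y in 𝓝 x,
    y.1 ∈ (chartAt H₁ x.1).source ∧ y.2 ∈ (chartAt H₂ x.2).source :=
  (continuousAt_fst.eventually (eventually_mem_chart_source x.1)).and
    (continuousAt_snd.eventually (eventually_mem_chart_source x.2))

variable [RiemannianBundle (fun x : N₁ × N₂ ↦ TangentSpace (I₁.prod I₂) x)] {f : N₁ → ℝ}

lemma IsWarpedProduct.inner_horizontal_vertical (h : IsWarpedProduct (N₁ := N₁) (N₂ := N₂) I₁ I₂ f)
    (x : N₁ × N₂) (z : TangentSpace I₁ x.1) (w : TangentSpace I₂ x.2) :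
    ⟪horizontal (I₁ := I₁) (I₂ := I₂) x z, vertical x w⟫_ℝ = 0 := by
  obtain ⟨g₁, g₂, hg⟩ := h.metric
  have e1 : mfderiv (I₁.prod I₂) I₁ Prod.fst x (vertical x w) = 0 :=
    DFunLike.congr_fun (mfderiv_fst (I := I₁) (I' := I₂) (x := x)) _
  have e2 : mfderiv (I₁.prod I₂) I₂ Prod.snd x (horizontal x z) = 0 :=
    DFunLike.congr_fun (mfderiv_snd (I := I₁) (I' := I₂) (x := x)) _
  rw [hg, e1, e2]
  simp

/-- What matters is that `k` does not depend on the base point: horizontal derivatives of the fibre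
metric then act on `f ^ 2` alone. -/
lemma IsWarpedProduct.exists_inner_vertical
    (h : IsWarpedProduct (N₁ := N₁) (N₂ := N₂) I₁ I₂ f) :
    ∃ k : ∀ b : N₂, TangentSpace I₂ b → TangentSpace I₂ b → ℝ,
      ∀ (x : N₁ × N₂) (v w : TangentSpace I₂ x.2),
        ⟪vertical (I₁ := I₁) (I₂ := I₂) x v, vertical x w⟫_ℝ = f x.1 ^ 2 * k x.2 v w := by
  obtain ⟨g₁, g₂, hg⟩ := h.metric
  refine ⟨fun b v w ↦ g₂.inner b v w, fun x v w ↦ ?_⟩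
  have e1 : ∀ w, mfderiv (I₁.prod I₂) I₁ Prod.fst x (vertical x w) = 0 := fun w ↦
    DFunLike.congr_fun (mfderiv_fst (I := I₁) (I' := I₂) (x := x)) _
  have e2 : ∀ w, mfderiv (I₁.prod I₂) I₂ Prod.snd x (vertical x w) = w := fun w ↦
    DFunLike.congr_fun (mfderiv_snd (I := I₁) (I' := I₂) (x := x)) _
  rw [hg, e1, e1, e2, e2]
  simp

lemma IsWarpedProduct.mdifferentiableAt_log (h : IsWarpedProduct (N₁ := N₁) (N₂ := N₂) I₁ I₂ f)
    (a : N₁) : MDifferentiableAt I₁ 𝓘(ℝ, ℝ) (fun a ↦ Real.log (f a)) a :=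
  (Real.differentiableAt_log (h.pos a).ne').mdifferentiableAt.comp a
    ((h.smooth a).mdifferentiableAt (by simp))

/-- The derivative of the metric of the fibres in horizontal directions. -/
lemma IsWarpedProduct.mvfderiv_inner_vertical
    (h : IsWarpedProduct (N₁ := N₁) (N₂ := N₂) I₁ I₂ f) (x : N₁ × N₂)
    (v w : TangentSpace I₂ x.2) (z : TangentSpace I₁ x.1)
    (hd : MDifferentiableAt (I₁.prod I₂) 𝓘(ℝ, ℝ) (fun y ↦
      ⟪FiberBundle.extend (E₁ × E₂) (vertical (I₁ := I₁) (I₂ := I₂) x v) y,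
        FiberBundle.extend (E₁ × E₂) (vertical (I₁ := I₁) (I₂ := I₂) x w) y⟫_ℝ) x) :
    mvfderiv (I₁.prod I₂) (fun y ↦
      ⟪FiberBundle.extend (E₁ × E₂) (vertical (I₁ := I₁) (I₂ := I₂) x v) y,
        FiberBundle.extend (E₁ × E₂) (vertical (I₁ := I₁) (I₂ := I₂) x w) y⟫_ℝ) x
        (horizontal x z) =
      2 * mvfderiv I₁ (fun a ↦ Real.log (f a)) x.1 z *
        ⟪vertical (I₁ := I₁) (I₂ := I₂) x v, vertical x w⟫_ℝ := by
  obtain ⟨k, hk⟩ := h.exists_inner_vertical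
  have hf : MDifferentiableAt I₁ 𝓘(ℝ, ℝ) f x.1 := (h.smooth x.1).mdifferentiableAt (by simp)
  have hmk : MDifferentiableAt I₁ (I₁.prod I₂) (fun a : N₁ ↦ (a, x.2)) x.1 :=
    mdifferentiableAt_id.prodMk mdifferentiableAt_const
  have e := mvfderiv_comp_apply (F := fun a : N₁ ↦ (a, x.2)) (x := x.1) hd hmk z
  rw [mfderiv_mk_left] at e
  refine e.symm.trans ?_
  -- On the slice `a ↦ (a, x.2)` the vertical coordinate fields have fixed fibre components, so the
  -- inner product is `f ^ 2` times a constant.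
  have e2 : (fun a : N₁ ↦
      ⟪FiberBundle.extend (E₁ × E₂) (vertical (I₁ := I₁) (I₂ := I₂) x v) (a, x.2),
        FiberBundle.extend (E₁ × E₂) (vertical (I₁ := I₁) (I₂ := I₂) x w) (a, x.2)⟫_ℝ)
      =ᶠ[𝓝 x.1] fun a ↦ (f a * f a) * k x.2 v w := by
    filter_upwards [eventually_mem_chart_source (H := H₁) x.1] with a ha
    rw [extend_vertical (y := (a, x.2)) ha (mem_chart_source H₂ x.2),
      extend_vertical (y := (a, x.2)) ha (mem_chart_source H₂ x.2), hk,
      FiberBundle.extend_apply_self, FiberBundle.extend_apply_self, sq]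
  have e3 : mvfderiv I₁ (fun a ↦ Real.log (f a)) x.1 z = (f x.1)⁻¹ * mvfderiv I₁ f x.1 z := by
    rw [mvfderiv_comp_apply (I := 𝓘(ℝ, ℝ)) (F := f) (g := Real.log)
      (Real.differentiableAt_log (h.pos x.1).ne').mdifferentiableAt hf]
    have h5 : mfderiv 𝓘(ℝ, ℝ) 𝓘(ℝ, ℝ) Real.log (f x.1) = fderiv ℝ Real.log (f x.1) :=
      mfderiv_eq_fderiv
    refine (DFunLike.congr_fun h5 _).trans ?_
    rw [(Real.hasDerivAt_log (h.pos x.1).ne').hasFDerivAt.fderiv]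
    exact mul_comm (G := ℝ) _ _
  have hff : MDifferentiableAt I₁ 𝓘(ℝ, ℝ) (fun a ↦ f a * f a) x.1 := by
    simpa only [smul_eq_mul] using! hf.smul hf
  rw [mvfderiv_congr e2, mvfderiv_fun_mul hff mdifferentiableAt_const,
    mvfderiv_fun_mul hf hf, mvfderiv_const, e3, hk]
  simp only [add_apply, smul_apply, zero_apply, smul_eq_mul]
  have := (h.pos x.1).ne'
  field_simp
  ring

/-! ### Warped products with invariant fibres in a Kenmotsu manifold -/

section Immersed

variable {E : Type*} [NormedAddCommGroup E] [NormedSpace ℝ E] [FiniteDimensional ℝ E]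
  {H : Type*} [TopologicalSpace H] {I : ModelWithCorners ℝ E H}
  {N : Type*} [TopologicalSpace N] [ChartedSpace H N] [IsManifold I ∞ N]
  [RiemannianBundle (fun x : N ↦ TangentSpace I x)]
  [IsContMDiffRiemannianBundle I ∞ E (fun y : N ↦ TangentSpace I y)]
  [I₁.Boundaryless] [I₂.Boundaryless]
  {D : CovariantDerivative I E (TangentSpace I : N → Type _)} {F : N₁ × N₂ → N}

/-- Koszul's formula for a warped product isometrically immersed in `N`. -/
lemma inner_covAlong_mapExtend_horizontal (hD : IsLeviCivita D)
    (hF : IsIsometricImmersion (I₁.prod I₂) I F)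
    (h : IsWarpedProduct (N₁ := N₁) (N₂ := N₂) I₁ I₂ f) (x : N₁ × N₂)
    (v w : TangentSpace I₂ x.2) (z : TangentSpace I₁ x.1) :
    ⟪covAlong D F (mapExtend I F (horizontal (I₁ := I₁) (I₂ := I₂) x z)) x
        (vertical (I₁ := I₁) (I₂ := I₂) x v), mfderiv (I₁.prod I₂) I F x (vertical x w)⟫_ℝ =
      mvfderiv I₁ (fun a ↦ Real.log (f a)) x.1 z *
        ⟪vertical (I₁ := I₁) (I₂ := I₂) x v, vertical x w⟫_ℝ ∧
    ⟪covAlong D F (mapExtend I F (vertical (I₁ := I₁) (I₂ := I₂) x w)) x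
        (vertical (I₁ := I₁) (I₂ := I₂) x v), mfderiv (I₁.prod I₂) I F x (horizontal x z)⟫_ℝ =
      -(mvfderiv I₁ (fun a ↦ Real.log (f a)) x.1 z *
        ⟪vertical (I₁ := I₁) (I₂ := I₂) x v, vertical x w⟫_ℝ) := by
  have hd : ∀ u : TangentSpace (I₁.prod I₂) x,
      MDiffAlong (I₁.prod I₂) (mapExtend I F u) x := fun u ↦ mdiffAlong_mapExtend hF.smooth u
  have hiso : ∀ u u' : TangentSpace (I₁.prod I₂) x,
      (fun y ↦ ⟪mapExtend I F u y, mapExtend I F u' y⟫_ℝ) =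
      fun y ↦ ⟪FiberBundle.extend (E₁ × E₂) u y, FiberBundle.extend (E₁ × E₂) u' y⟫_ℝ :=
    fun u u' ↦ funext fun y ↦ hF.isometry y _ _
  have hm : ∀ u u' a : TangentSpace (I₁.prod I₂) x,
      mvfderiv (I₁.prod I₂) (fun y ↦ ⟪FiberBundle.extend (E₁ × E₂) u y,
        FiberBundle.extend (E₁ × E₂) u' y⟫_ℝ) x a =
      ⟪covAlong D F (mapExtend I F u) x a, mfderiv (I₁.prod I₂) I F x u'⟫_ℝ +
      ⟪covAlong D F (mapExtend I F u') x a, mfderiv (I₁.prod I₂) I F x u⟫_ℝ := by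
    intro u u' a
    have := hD.mvfderiv_inner (hd u) (hd u') a
    rwa [hiso, mapExtend_self, mapExtend_self,
      real_inner_comm (covAlong D F (mapExtend I F u') x a)] at this
  have hsymm : ∀ u u' : TangentSpace (I₁.prod I₂) x, covAlong D F (mapExtend I F u) x u' =
      covAlong D F (mapExtend I F u') x u := fun u u' ↦
    covAlong_mapExtend_comm hD.torsion_free hF.smooth u' u
  have hzero : ∀ v : TangentSpace I₂ x.2, (fun y ↦
      ⟪FiberBundle.extend (E₁ × E₂) (vertical (I₁ := I₁) (I₂ := I₂) x v) y,
        FiberBundle.extend (E₁ × E₂) (horizontal (I₁ := I₁) (I₂ := I₂) x z) y⟫_ℝ) =ᶠ[𝓝 x]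
      fun _ ↦ (0 : ℝ) := by
    intro v
    filter_upwards [eventually_mem_chart_source_prod (H₁ := H₁) (H₂ := H₂) x] with y hy
    rw [extend_vertical hy.1 hy.2, extend_horizontal hy.1 hy.2, real_inner_comm]
    exact h.inner_horizontal_vertical y _ _
  -- `k1` and `k2` differentiate `g(vertical, horizontal) = 0`; with the symmetry of `∇` they give
  -- `g(∇_v Z, w) = g(∇_w Z, v)`. By `k3` these two terms add up to `2 Z(ln f) g(v, w)`.
  have k1 := hm (vertical x w) (horizontal x z) (vertical x v)
  rw [mvfderiv_congr (hzero w), mvfderiv_const, zero_apply] at k1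
  have k2 := hm (vertical x v) (horizontal x z) (vertical x w)
  rw [mvfderiv_congr (hzero v), mvfderiv_const, zero_apply] at k2
  -- Differentiability of the induced metric on coordinate fields is inherited from the ambient
  -- metric through the isometry.
  have hdvw := (hd (vertical x v)).inner (hd (vertical x w))
  rw [hiso] at hdvw
  have k3 := hm (vertical x v) (vertical x w) (horizontal x z)
  rw [h.mvfderiv_inner_vertical x v w z hdvw] at k3
  rw [hsymm (vertical x v) (vertical x w)] at k2
  rw [hsymm (vertical x v) (horizontal x z), hsymm (vertical x w) (horizontal x z)] at k3
  constructor <;> linarith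

variable {S : AlmostContactMetric I N}

/-- The symmetry obstruction: for vertical `X`, `Y` and horizontal `Z`,
`g(∇_X Y, φ Z) = g(φ X, Y) (η(Z) - Z (ln f))`. -/
lemma inner_covAlong_φ (hS : IsKenmotsu S D) (hF : IsIsometricImmersion (I₁.prod I₂) I F)
    (h : IsWarpedProduct (N₁ := N₁) (N₂ := N₂) I₁ I₂ f)
    (hinv : ∀ (y : N₁ × N₂) (w : TangentSpace I₂ y.2), ∃ w' : TangentSpace I₂ y.2,
      S.φ (F y) (mfderiv (I₁.prod I₂) I F y (vertical y w)) =
        mfderiv (I₁.prod I₂) I F y (vertical y w'))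
    (hη : ∀ (y : N₁ × N₂) (w : TangentSpace I₂ y.2),
      S.η (F y) (mfderiv (I₁.prod I₂) I F y (vertical y w)) = 0)
    (x : N₁ × N₂) (v w : TangentSpace I₂ x.2) (z : TangentSpace I₁ x.1) :
    ⟪covAlong D F (mapExtend I F (vertical (I₁ := I₁) (I₂ := I₂) x w)) x
        (vertical (I₁ := I₁) (I₂ := I₂) x v),
        S.φ (F x) (mfderiv (I₁.prod I₂) I F x (horizontal x z))⟫_ℝ =
      ⟪S.φ (F x) (mfderiv (I₁.prod I₂) I F x (vertical x v)),
        mfderiv (I₁.prod I₂) I F x (vertical x w)⟫_ℝ *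
      (S.η (F x) (mfderiv (I₁.prod I₂) I F x (horizontal x z)) -
        mvfderiv I₁ (fun a ↦ Real.log (f a)) x.1 z) := by
  have hd : ∀ u : TangentSpace (I₁.prod I₂) x,
      MDiffAlong (I₁.prod I₂) (mapExtend I F u) x := fun u ↦ mdiffAlong_mapExtend hF.smooth u
  have hzero : (fun y ↦ ⟪S.φ (F y) (mapExtend I F (vertical (I₁ := I₁) (I₂ := I₂) x w) y),
      mapExtend I F (horizontal (I₁ := I₁) (I₂ := I₂) x z) y⟫_ℝ) =ᶠ[𝓝 x] fun _ ↦ (0 : ℝ) := by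
    filter_upwards [eventually_mem_chart_source_prod (H₁ := H₁) (H₂ := H₂) x] with y hy
    obtain ⟨w', hw'⟩ := hinv y (FiberBundle.extend E₂ w y.2)
    rw [mapExtend, mapExtend, extend_vertical hy.1 hy.2, extend_horizontal hy.1 hy.2, hw',
      hF.isometry, real_inner_comm]
    exact h.inner_horizontal_vertical y _ _
  -- This is `0 = g(∇_v (φW), Z) + g(φW, ∇_v Z)`. The Kenmotsu equation expands the first term, its
  -- `η(W)` part being zero; the warped product formula evaluates the second, since `φW` is
  -- vertical.
  have k := hS.leviCivita.mvfderiv_inner (S.mdiffAlong_φ (hd (vertical x w)))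
    (hd (horizontal x z)) (vertical x v)
  obtain ⟨w', hw'⟩ := hinv x w
  rw [mvfderiv_congr hzero, mvfderiv_const, zero_apply, hS.covAlong_φ (hd _), mapExtend_self,
    mapExtend_self, hη, zero_smul, sub_zero, hw', real_inner_comm (covAlong D F _ x _),
    (inner_covAlong_mapExtend_horizontal hS.leviCivita hF h x v w' z).1, ← hF.isometry, ← hw',
    inner_add_left, inner_smul_left, S.φ_skew, real_inner_comm _ (S.ξ (F x)), ← S.η_eq,
    ← neg_neg ⟪mfderiv (I₁.prod I₂) I F x (vertical x v),
      S.φ (F x) (mfderiv (I₁.prod I₂) I F x (vertical x w))⟫_ℝ, ← S.φ_skew] at k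
  rw [RCLike.conj_to_real, neg_neg, S.φ_skew,
    S.φ_skew (F x) (mfderiv (I₁.prod I₂) I F x (vertical x v))] at k
  rw [S.φ_skew (F x) (mfderiv (I₁.prod I₂) I F x (vertical x v))]
  linarith

/-- If the fibres of a warped product in a Kenmotsu manifold are invariant, then `Z (ln f) = η(Z)`
for all horizontal `Z`. -/
lemma mvfderiv_log_eq_η (hS : IsKenmotsu S D) (hF : IsIsometricImmersion (I₁.prod I₂) I F)
    (h : IsWarpedProduct (N₁ := N₁) (N₂ := N₂) I₁ I₂ f)
    (hinv : ∀ (y : N₁ × N₂) (w : TangentSpace I₂ y.2), ∃ w' : TangentSpace I₂ y.2,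
      S.φ (F y) (mfderiv (I₁.prod I₂) I F y (vertical y w)) =
        mfderiv (I₁.prod I₂) I F y (vertical y w'))
    (hη : ∀ (y : N₁ × N₂) (w : TangentSpace I₂ y.2),
      S.η (F y) (mfderiv (I₁.prod I₂) I F y (vertical y w)) = 0)
    (x : N₁ × N₂) {w : TangentSpace I₂ x.2} (hw : w ≠ 0) (z : TangentSpace I₁ x.1) :
    mvfderiv I₁ (fun a ↦ Real.log (f a)) x.1 z =
      S.η (F x) (mfderiv (I₁.prod I₂) I F x (horizontal x z)) := by
  obtain ⟨w', hw'⟩ := hinv x w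
  -- With `w' = φ w`, exchanging the arguments keeps the left side and turns the factor `|w|²` on
  -- the right into `-|w|²`.
  have k1 := inner_covAlong_φ hS hF h hinv hη x w w' z
  have k2 := inner_covAlong_φ hS hF h hinv hη x w' w z
  rw [covAlong_mapExtend_comm hS.leviCivita.torsion_free hF.smooth, k2, S.φ_skew, ← hw',
    S.φ_isometry, hη, real_inner_comm] at k1
  rw [hF.isometry] at k1
  have hne : ⟪vertical (I₁ := I₁) (I₂ := I₂) x w, vertical x w⟫_ℝ ≠ 0 :=
    inner_self_ne_zero.2 fun h0 ↦ hw (congrArg Prod.snd h0)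
  have : ⟪vertical (I₁ := I₁) (I₂ := I₂) x w, vertical x w⟫_ℝ *
    (S.η (F x) (mfderiv (I₁.prod I₂) I F x (horizontal x z)) -
        mvfderiv I₁ (fun a ↦ Real.log (f a)) x.1 z) = 0 := by linarith
  linarith [(mul_eq_zero.1 this).resolve_left hne]

end Immersed

end Warped

/-! ### The leaves of a totally geodesic warped product -/

section Leaves

variable {E₁ : Type*} [NormedAddCommGroup E₁] [NormedSpace ℝ E₁] [FiniteDimensional ℝ E₁]
  {H₁ : Type*} [TopologicalSpace H₁] {I₁ : ModelWithCorners ℝ E₁ H₁} [I₁.Boundaryless]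
  {N₁ : Type*} [TopologicalSpace N₁] [ChartedSpace H₁ N₁] [IsManifold I₁ ∞ N₁]
  {E₂ : Type*} [NormedAddCommGroup E₂] [NormedSpace ℝ E₂] [FiniteDimensional ℝ E₂]
  {H₂ : Type*} [TopologicalSpace H₂] {I₂ : ModelWithCorners ℝ E₂ H₂} [I₂.Boundaryless]
  {N₂ : Type*} [TopologicalSpace N₂] [ChartedSpace H₂ N₂] [IsManifold I₂ ∞ N₂]
  [RiemannianBundle (fun x : N₁ × N₂ ↦ TangentSpace (I₁.prod I₂) x)] {f : N₁ → ℝ}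
  {E : Type*} [NormedAddCommGroup E] [NormedSpace ℝ E] [FiniteDimensional ℝ E]
  {H : Type*} [TopologicalSpace H] {I : ModelWithCorners ℝ E H}
  {N : Type*} [TopologicalSpace N] [ChartedSpace H N] [IsManifold I ∞ N]
  [RiemannianBundle (fun x : N ↦ TangentSpace I x)]
  [IsContMDiffRiemannianBundle I ∞ E (fun y : N ↦ TangentSpace I y)]
  {D : CovariantDerivative I E (TangentSpace I : N → Type _)} {F : N₁ × N₂ → N}
  {S : AlmostContactMetric I N}

omit [FiniteDimensional ℝ E₁] [I₁.Boundaryless] [FiniteDimensional ℝ E₂] [I₂.Boundaryless]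
  [FiniteDimensional ℝ E] [IsManifold I ∞ N]
  [RiemannianBundle (fun x : N₁ × N₂ ↦ TangentSpace (I₁.prod I₂) x)]
  [RiemannianBundle (fun x : N ↦ TangentSpace I x)]
  [IsContMDiffRiemannianBundle I ∞ E (fun y : N ↦ TangentSpace I y)] in
-- This lets `covAlong_precomp` turn derivatives along the leaf into derivatives along `F` in
-- vertical directions.
lemma mapExtend_leaf (hF : ContMDiff (I₁.prod I₂) I ∞ F) (m : N₁) {c : N₂}
    (v : TangentSpace I₂ c) :
    mapExtend I (fun b ↦ F (m, b)) v =ᶠ[𝓝 c]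
      fun b ↦ mapExtend I F (vertical (I₁ := I₁) (I₂ := I₂) (m, c) v) (m, b) := by
  filter_upwards [eventually_mem_chart_source (H := H₂) c] with b hb
  rw [mapExtend, mapExtend, extend_vertical (x := (m, c)) (y := (m, b)) (mem_chart_source H₁ m) hb,
    ← mfderiv_mk_right]
  exact congr($(mfderiv_comp b ((hF (m, b)).mdifferentiableAt (by simp))
    (mdifferentiableAt_const.prodMk mdifferentiableAt_id)) _)

/-- The fibres of a totally geodesic warped product in a Kenmotsu manifold are totally umbilical
if they are invariant. -/
lemma isTotallyUmbilical_leaf (hS : IsKenmotsu S D) (hF : IsIsometricImmersion (I₁.prod I₂) I F)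
    (h : IsWarpedProduct (N₁ := N₁) (N₂ := N₂) I₁ I₂ f)
    (hinv : ∀ (y : N₁ × N₂) (w : TangentSpace I₂ y.2), ∃ w' : TangentSpace I₂ y.2,
      S.φ (F y) (mfderiv (I₁.prod I₂) I F y (vertical y w)) =
        mfderiv (I₁.prod I₂) I F y (vertical y w'))
    (hξ : ∀ y : N₁ × N₂, ∃ z : TangentSpace I₁ y.1,
      mfderiv (I₁.prod I₂) I F y (horizontal y z) = S.ξ (F y))
    (hη : ∀ (y : N₁ × N₂) (w : TangentSpace I₂ y.2),
      S.η (F y) (mfderiv (I₁.prod I₂) I F y (vertical y w)) = 0)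
    (hg : IsTotallyGeodesic (I₁.prod I₂) D F) (m : N₁) :
    IsTotallyUmbilical I₂ D (fun c : N₂ ↦ F (m, c)) := by
  intro c
  set x : N₁ × N₂ := (m, c) with hx
  have hdF := (hF.smooth x).mdifferentiableAt (n := ∞) (by simp)
  have hmk : MDifferentiableAt I₂ (I₁.prod I₂) (fun b : N₂ ↦ (m, b)) c :=
    mdifferentiableAt_const.prodMk mdifferentiableAt_id
  have hd : ∀ w : TangentSpace I₂ c, mfderiv I₂ I (fun b ↦ F (m, b)) c w =
      mfderiv (I₁.prod I₂) I F x (vertical (I₁ := I₁) (I₂ := I₂) x w) := by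
    intro w
    rw [← mfderiv_mk_right]
    exact congr($(mfderiv_comp c hdF hmk) w)
  obtain ⟨z₀, hz₀⟩ := hξ x
  refine ⟨-S.ξ (F x), fun u v ↦ ?_⟩
  rw [hd, hd, hF.isometry]
  have hcov : covAlong D (fun b ↦ F (m, b)) (mapExtend I (fun b ↦ F (m, b)) v) c u =
      covAlong D F (mapExtend I F (vertical (I₁ := I₁) (I₂ := I₂) x v)) x
        (vertical (I₁ := I₁) (I₂ := I₂) x u) := by
    have h0 := mapExtend_leaf (I := I) (I₁ := I₁) (I₂ := I₂) (F := F) hF.smooth m (c := c) v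
    have h1 := congrFun (covAlong_congr (D := D) (J := I₂) h0) u
    refine h1.trans ?_
    have h2 := covAlong_precomp (D := D) (ι := fun b : N₂ ↦ (m, b)) (q := c)
      (mdiffAlong_mapExtend hF.smooth (vertical (I₁ := I₁) (I₂ := I₂) x v)) hmk u
    refine h2.trans ?_
    exact congrArg (covAlong D F (mapExtend I F (vertical (I₁ := I₁) (I₂ := I₂) x v)) x)
      (mfderiv_mk_right x u)
  set n := covAlong D F (mapExtend I F (vertical (I₁ := I₁) (I₂ := I₂) x v)) x
    (vertical (I₁ := I₁) (I₂ := I₂) x u)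
    with hn
  -- Here `h = 0` enters: `n` has no component normal to `M`, so it splits into a horizontal and a
  -- vertical part.
  have hrange : n ∈ LinearMap.range (mfderiv (I₁.prod I₂) I F x).toLinearMap := by
    have h1 : (LinearMap.range (mfderiv (I₁.prod I₂) I F x).toLinearMap)ᗮ.starProjection n = 0 :=
      hg x (vertical x u) (vertical x v)
    rw [Submodule.starProjection_apply_eq_zero_iff, Submodule.orthogonal_orthogonal] at h1
    exact h1
  obtain ⟨a₁, a₂, ha⟩ : ∃ (a₁ : TangentSpace I₁ x.1) (a₂ : TangentSpace I₂ x.2),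
      mfderiv (I₁.prod I₂) I F x (horizontal x a₁ + vertical x a₂) = n := by
    obtain ⟨a, ha⟩ := hrange
    exact ⟨a.1, a.2, (congrArg _ (horizontal_add_vertical x a)).trans ha⟩
  have hinner : ∀ z : TangentSpace I₁ x.1,
      ⟪n, mfderiv (I₁.prod I₂) I F x (horizontal x z)⟫_ℝ =
        -(⟪mfderiv (I₁.prod I₂) I F x (horizontal x z), S.ξ (F x)⟫_ℝ *
          ⟪vertical (I₁ := I₁) (I₂ := I₂) x u, vertical x v⟫_ℝ) := by
    intro z
    -- The identity `Z(ln f) = η(Z)` needs a nonzero vertical vector, and `u` serves as one; for `u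
    -- = 0` both sides vanish.
    by_cases hu : u = 0
    · have hu' : vertical (I₁ := I₁) (I₂ := I₂) x u = (0 : ℝ) • vertical x u := by
        rw [zero_smul, hu]
        rfl
      rw [hn, hu', covAlong_smul_dir]
      simp
    · rw [(inner_covAlong_mapExtend_horizontal hS.leviCivita hF h x u v z).2,
        mvfderiv_log_eq_η hS hF h hinv hη x hu z, S.η_eq]
  set κ := ⟪vertical (I₁ := I₁) (I₂ := I₂) x u, vertical x v⟫_ℝ with hκ
  have hsum : horizontal (I₁ := I₁) (I₂ := I₂) x (a₁ + κ • z₀) =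
      horizontal x a₁ + κ • horizontal x z₀ :=
    Prod.ext rfl ((congrArg (0 + ·) (smul_zero κ)).trans (add_zero _)).symm
  -- By `hinner` this vector is orthogonal to every horizontal vector; being horizontal, it is
  -- orthogonal to itself. Thus the horizontal part of `n` is `-κ ξ`.
  have hzero : horizontal (I₁ := I₁) (I₂ := I₂) x a₁ + κ • horizontal x z₀ = 0 := by
    rw [← inner_self_eq_zero (𝕜 := ℝ)]
    have h2 : ⟪mfderiv (I₁.prod I₂) I F x (horizontal x a₁ + vertical x a₂ + κ • horizontal x z₀),
        mfderiv (I₁.prod I₂) I F x (horizontal x (a₁ + κ • z₀))⟫_ℝ = 0 := by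
      rw [map_add, map_smul, inner_add_left, ha, hinner, hz₀, inner_smul_left,
        RCLike.conj_to_real, real_inner_comm (S.ξ (F x))]
      ring
    rw [hF.isometry, add_right_comm, inner_add_left, real_inner_comm _ (vertical x a₂),
      h.inner_horizontal_vertical, add_zero, hsum] at h2
    exact h2
  have hn' : n = mfderiv (I₁.prod I₂) I F x (vertical x a₂) + κ • -S.ξ (F x) := by
    rw [← ha, ← hz₀, eq_neg_of_add_eq_zero_left hzero, map_add, map_neg, map_smul, smul_neg,
      add_comm]
  change (LinearMap.range (mfderiv I₂ I (fun b ↦ F (m, b)) c).toLinearMap)ᗮ.starProjection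
    (covAlong D (fun b ↦ F (m, b)) (mapExtend I (fun b ↦ F (m, b)) v) c u) = _
  rw [hcov, hn', map_add, map_smul]
  have hp1 : (LinearMap.range (mfderiv I₂ I (fun b ↦ F (m, b)) c).toLinearMap)ᗮ.starProjection
      (mfderiv (I₁.prod I₂) I F x (vertical x a₂)) = 0 := by
    rw [Submodule.starProjection_apply_eq_zero_iff, Submodule.orthogonal_orthogonal]
    exact ⟨a₂, hd a₂⟩
  have hp2 : (LinearMap.range (mfderiv I₂ I (fun b ↦ F (m, b)) c).toLinearMap)ᗮ.starProjection
      (-S.ξ (F x)) = -S.ξ (F x) := by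
    rw [Submodule.starProjection_eq_self_iff]
    refine Submodule.neg_mem _ ((Submodule.mem_orthogonal _ _).2 ?_)
    rintro _ ⟨w, rfl⟩
    have h1 := hη x w
    rw [S.η_eq, ← hd] at h1
    exact h1
  rw [hp1, hp2, zero_add]

end Leaves

/-! ### The operator `P` and its eigendistributions -/

section Main

variable {E : Type*} [NormedAddCommGroup E] [NormedSpace ℝ E] [FiniteDimensional ℝ E]
  {H : Type*} [TopologicalSpace H] {I : ModelWithCorners ℝ E H}
  {N : Type*} [TopologicalSpace N] [ChartedSpace H N] [IsManifold I ∞ N]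
  [RiemannianBundle (fun x : N ↦ TangentSpace I x)] {S : AlmostContactMetric I N}
  {E' : Type*} [NormedAddCommGroup E'] [NormedSpace ℝ E'] [FiniteDimensional ℝ E']
  {H' : Type*} [TopologicalSpace H'] {J : ModelWithCorners ℝ E' H'}
  {L : Type*} [TopologicalSpace L] [ChartedSpace H' L]
  [RiemannianBundle (fun x : L ↦ TangentSpace J x)] {F : L → N}

lemma inner_tangentialPhi (x : L) (u v : TangentSpace J x) :
    ⟪u, tangentialPhi S F x v⟫_ℝ =
      ⟪mfderiv J I F x u, S.φ (F x) (mfderiv J I F x v)⟫_ℝ :=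
  LinearMap.adjoint_inner_right (mfderiv J I F x).toLinearMap u
    (S.φ (F x) (mfderiv J I F x v))

lemma mem_eigenDistribution {c : ℝ} {x : L} {v : TangentSpace J x} :
    v ∈ eigenDistribution S F c x ↔
      tangentialPhi S F x (tangentialPhi S F x v) + c ^ 2 • v = 0 := Iff.rfl

lemma tangentialPhi_mem_eigenDistribution {c : ℝ} {x : L} {v : TangentSpace J x}
    (hv : v ∈ eigenDistribution S F c x) :
    tangentialPhi S F x v ∈ eigenDistribution S F c x := by
  rw [mem_eigenDistribution] at *
  rw [← map_smul, ← map_add, hv, map_zero]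

/-- On the invariant distribution, `φ` is tangential. -/
lemma φ_eq_mfderiv_tangentialPhi (hF : IsIsometricImmersion J I F) {x : L} {v : TangentSpace J x}
    (hv : v ∈ eigenDistribution S F 1 x) (hη : S.η (F x) (mfderiv J I F x v) = 0) :
    S.φ (F x) (mfderiv J I F x v) = mfderiv J I F x (tangentialPhi S F x v) := by
  -- `dF (P v)` is the projection of `φ (dF v)` to the tangent space; since `P² v = -v` and `η`
  -- vanishes on `dF v`, both have the length of `v`, so nothing is lost in projecting.
  have h1 : ⟪tangentialPhi S F x v, tangentialPhi S F x v⟫_ℝ = ⟪v, v⟫_ℝ := by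
    rw [mem_eigenDistribution, one_pow, one_smul] at hv
    have h2 := inner_tangentialPhi (S := S) (F := F) x v (tangentialPhi S F x v)
    rw [eq_neg_of_add_eq_zero_left hv, inner_neg_right] at h2
    rw [inner_tangentialPhi, real_inner_comm, S.φ_skew, ← h2, neg_neg]
  have h3 : ⟪mfderiv J I F x (tangentialPhi S F x v), S.φ (F x) (mfderiv J I F x v)⟫_ℝ =
      ⟪v, v⟫_ℝ := by
    rw [← inner_tangentialPhi, h1]
  have h4 : ⟪S.φ (F x) (mfderiv J I F x v), mfderiv J I F x (tangentialPhi S F x v)⟫_ℝ =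
      ⟪v, v⟫_ℝ := by
    rw [real_inner_comm, h3]
  rw [← sub_eq_zero, ← inner_self_eq_zero (𝕜 := ℝ), inner_sub_left, inner_sub_right,
    inner_sub_right, h3, h4, hF.isometry, h1, S.φ_isometry, hη, hF.isometry]
  ring

/-- The slant distribution is orthogonal to `ξ`. -/
lemma inner_eq_zero_of_mem_eigenDistribution {c : ℝ} (hc : c ≠ 0) {x : L} {u v : TangentSpace J x}
    (hu : mfderiv J I F x u = S.ξ (F x)) (hv : v ∈ eigenDistribution S F c x) :
    ⟪u, v⟫_ℝ = 0 := by
  -- For `c ≠ 0`, `v` is a multiple of `P (P v)`, and the image of `P` is orthogonal to `ξ` because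
  -- `η ∘ φ = 0`.
  have h := inner_tangentialPhi (S := S) (F := F) x u (tangentialPhi S F x v)
  rw [mem_eigenDistribution] at hv
  rw [hu, eq_neg_of_add_eq_zero_left hv, real_inner_comm _ (S.ξ (F x)), ← S.η_eq, S.η_φ,
    inner_neg_right, inner_smul_right, neg_eq_zero] at h
  exact (mul_eq_zero.1 h).resolve_left (pow_ne_zero 2 hc)

end Main

/-! ### Skew CR warped products: `grad ln f = ξ` and the vanishing of the bound -/

section SkewCR

variable {E₁ : Type*} [NormedAddCommGroup E₁] [NormedSpace ℝ E₁] [FiniteDimensional ℝ E₁]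
  {A : Type*} [TopologicalSpace A] [ChartedSpace E₁ A] [IsManifold 𝓘(ℝ, E₁) ∞ A]
  {E₂ : Type*} [NormedAddCommGroup E₂] [NormedSpace ℝ E₂] [FiniteDimensional ℝ E₂]
  {B : Type*} [TopologicalSpace B] [ChartedSpace E₂ B] [IsManifold 𝓘(ℝ, E₂) ∞ B]
  {E₃ : Type*} [NormedAddCommGroup E₃] [NormedSpace ℝ E₃] [FiniteDimensional ℝ E₃]
  {C : Type*} [TopologicalSpace C] [ChartedSpace E₃ C] [IsManifold 𝓘(ℝ, E₃) ∞ C]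
  {E : Type*} [NormedAddCommGroup E] [NormedSpace ℝ E] [FiniteDimensional ℝ E]
  {N : Type*} [TopologicalSpace N] [ChartedSpace E N] [IsManifold 𝓘(ℝ, E) ∞ N]
  [RiemannianBundle (fun y : N ↦ TangentSpace 𝓘(ℝ, E) y)]
  [RiemannianBundle (fun x : (A × B) × C ↦ TangentSpace (model₃ E₁ E₂ E₃) x)]
  {S : AlmostContactMetric 𝓘(ℝ, E) N} {F : (A × B) × C → N} {f : A × B → ℝ} {θ : ℝ}

omit [FiniteDimensional ℝ E₁] [IsManifold 𝓘(ℝ, E₁) ∞ A] [FiniteDimensional ℝ E₂]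
  [IsManifold 𝓘(ℝ, E₂) ∞ B] [FiniteDimensional ℝ E₃] [IsManifold 𝓘(ℝ, E₃) ∞ C]
  [RiemannianBundle (fun x : (A × B) × C ↦ TangentSpace (model₃ E₁ E₂ E₃) x)] in
lemma exists_horizontal_of_mem_tangentFst {x : (A × B) × C}
    {u : TangentSpace (model₃ E₁ E₂ E₃) x} (hu : u ∈ tangentFst x) :
    ∃ z : TangentSpace (𝓘(ℝ, E₁).prod 𝓘(ℝ, E₂)) x.1, u = horizontal x z := by
  obtain ⟨a, rfl⟩ := hu
  have h1 : MDifferentiableAt 𝓘(ℝ, E₁) (𝓘(ℝ, E₁).prod 𝓘(ℝ, E₂)) (fun a : A ↦ (a, x.1.2)) x.1.1 :=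
    mdifferentiableAt_id.prodMk mdifferentiableAt_const
  have h2 : MDifferentiableAt (𝓘(ℝ, E₁).prod 𝓘(ℝ, E₂)) (model₃ E₁ E₂ E₃)
      (fun a : A × B ↦ (a, x.2)) x.1 :=
    mdifferentiableAt_id.prodMk mdifferentiableAt_const
  refine ⟨mfderiv 𝓘(ℝ, E₁) (𝓘(ℝ, E₁).prod 𝓘(ℝ, E₂)) (fun a : A ↦ (a, x.1.2)) x.1.1 a, ?_⟩
  rw [← mfderiv_mk_left]
  exact congr($(mfderiv_comp x.1.1 h2 h1) a)

namespace IsWarpedSkewCR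

variable (hM : IsWarpedSkewCR E₁ E₂ E₃ S F f θ)

include hM

lemma vertical_mem (x : (A × B) × C) (w : TangentSpace 𝓘(ℝ, E₃) x.2) :
    vertical x w ∈ eigenDistribution (J := model₃ E₁ E₂ E₃) S F 1 x := by
  rw [← hM.invariant]
  exact ⟨w, mfderiv_mk_right x w⟩

lemma exists_mfderiv_horizontal (x : (A × B) × C) :
    ∃ z : TangentSpace (𝓘(ℝ, E₁).prod 𝓘(ℝ, E₂)) x.1,
      horizontal x z ∈ tangentFst (E₁ := E₁) (E₂ := E₂) (E₃ := E₃) x ∧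
      mfderiv (model₃ E₁ E₂ E₃) 𝓘(ℝ, E) F x (horizontal x z) = S.ξ (F x) := by
  obtain ⟨u, hu, h⟩ := hM.ξ_tangent x
  obtain ⟨z, rfl⟩ := exists_horizontal_of_mem_tangentFst hu
  exact ⟨z, hu, h⟩

lemma η_vertical (x : (A × B) × C) (w : TangentSpace 𝓘(ℝ, E₃) x.2) :
    S.η (F x) (mfderiv (model₃ E₁ E₂ E₃) 𝓘(ℝ, E) F x (vertical x w)) = 0 := by
  obtain ⟨z, -, hz⟩ := hM.exists_mfderiv_horizontal x
  rw [S.η_eq, ← hz, hM.immersion.isometry, real_inner_comm]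
  exact hM.warped.inner_horizontal_vertical x z w

/-- The eigenspace of `P²` for `-1` is `P`-stable, and on it `φ` agrees with `P`; this supplies the
invariance of the fibres. -/
lemma exists_φ_vertical (x : (A × B) × C) (w : TangentSpace 𝓘(ℝ, E₃) x.2) :
    ∃ w' : TangentSpace 𝓘(ℝ, E₃) x.2,
      S.φ (F x) (mfderiv (model₃ E₁ E₂ E₃) 𝓘(ℝ, E) F x (vertical x w)) =
        mfderiv (model₃ E₁ E₂ E₃) 𝓘(ℝ, E) F x (vertical x w') := by
  have h := tangentialPhi_mem_eigenDistribution (hM.vertical_mem x w)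
  rw [← hM.invariant] at h
  obtain ⟨w', hw'⟩ := h
  refine ⟨w', ?_⟩
  rw [φ_eq_mfderiv_tangentialPhi hM.immersion (hM.vertical_mem x w) (hM.η_vertical x w), ← hw']
  exact congrArg _ (mfderiv_mk_right x w')

variable [IsContMDiffRiemannianBundle 𝓘(ℝ, E) ∞ E (fun y : N ↦ TangentSpace 𝓘(ℝ, E) y)]
  {D : CovariantDerivative 𝓘(ℝ, E) E (TangentSpace 𝓘(ℝ, E) : N → Type _)}

/-- If the invariant factor has positive dimension, then the gradient of `ln f` is `ξ`. -/
lemma gradLog_eq (hS : IsKenmotsu S D) [Nontrivial E₃] {x : (A × B) × C}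
    {z : TangentSpace (𝓘(ℝ, E₁).prod 𝓘(ℝ, E₂)) x.1}
    (hz : mfderiv (model₃ E₁ E₂ E₃) 𝓘(ℝ, E) F x (horizontal x z) = S.ξ (F x)) :
    gradLog E₁ E₂ E₃ f x = horizontal x z := by
  obtain ⟨w, hw⟩ := exists_ne (0 : E₃)
  have : CompleteSpace (TangentSpace (model₃ E₁ E₂ E₃) x) := FiniteDimensional.complete ℝ _
  have h : mvfderiv (model₃ E₁ E₂ E₃) (fun y : (A × B) × C ↦ Real.log (f y.1)) x =
      InnerProductSpace.toDual ℝ (TangentSpace (model₃ E₁ E₂ E₃) x) (horizontal x z) := by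
    ext u
    obtain ⟨a, b, rfl⟩ : ∃ (a : TangentSpace (𝓘(ℝ, E₁).prod 𝓘(ℝ, E₂)) x.1)
        (b : TangentSpace 𝓘(ℝ, E₃) x.2), u = horizontal x a + vertical x b :=
      ⟨u.1, u.2, (horizontal_add_vertical x u).symm⟩
    have h1 : mfderiv (model₃ E₁ E₂ E₃) (𝓘(ℝ, E₁).prod 𝓘(ℝ, E₂))
        (fun y : (A × B) × C ↦ y.1) x (horizontal x a + vertical x b) = a :=
      (DFunLike.congr_fun mfderiv_fst _).trans (add_zero a)
    rw [InnerProductSpace.toDual_apply_apply,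
      mvfderiv_comp_apply (F := fun y : (A × B) × C ↦ y.1) (g := fun a ↦ Real.log (f a))
      (hM.warped.mdifferentiableAt_log x.1) mdifferentiableAt_fst, h1,
      mvfderiv_log_eq_η hS hM.immersion hM.warped hM.exists_φ_vertical hM.η_vertical x
      (w := w) hw, S.η_eq, ← hz, hM.immersion.isometry, inner_add_right,
      hM.warped.inner_horizontal_vertical, add_zero, real_inner_comm]
  rw [gradLog, grad, h]
  exact LinearIsometryEquiv.symm_apply_apply _ _

/-- The lower bound for `‖h‖²` vanishes. -/
lemma bound_eq_zero (hS : IsKenmotsu S D) {p : ℕ} (hp : Module.finrank ℝ E₃ = 2 * p) (k : ℝ)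
    (x : (A × B) × C) :
    2 * (p : ℝ) * (‖gradLogPerp E₁ E₂ E₃ f x‖ ^ 2 - 1 +
      k * ‖gradLogSlant E₁ E₂ E₃ f x‖ ^ 2) = 0 := by
  -- For `p = 0` there is no nonzero vertical vector and `grad ln f` is not determined, but the
  -- factor `2p` is zero.
  rcases Nat.eq_zero_or_pos p with rfl | hpos
  · simp
  have : Nontrivial E₃ := Module.nontrivial_of_finrank_pos (R := ℝ) (by omega)
  obtain ⟨z, hz, hξ⟩ := hM.exists_mfderiv_horizontal x
  have h1 : gradLogPerp E₁ E₂ E₃ f x = horizontal x z := by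
    rw [gradLogPerp, hM.gradLog_eq hS hξ]
    exact Submodule.starProjection_eq_self_iff.2 hz
  -- Since `cos θ ≠ 0`, the slant distribution is orthogonal to `ξ`. The slant component being zero,
  -- the coefficient `k` can be arbitrary.
  have h2 : gradLogSlant E₁ E₂ E₃ f x = 0 := by
    rw [gradLogSlant, hM.gradLog_eq hS hξ, Submodule.starProjection_apply_eq_zero_iff,
      Submodule.mem_orthogonal]
    intro v hv
    rw [hM.slant] at hv
    rw [real_inner_comm]
    exact inner_eq_zero_of_mem_eigenDistribution
      (Real.cos_pos_of_mem_Ioo ⟨by linarith [hM.angle_pos, Real.pi_pos], hM.angle_lt⟩).ne' hξ hv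
  have h3 : ‖horizontal (I₁ := 𝓘(ℝ, E₁).prod 𝓘(ℝ, E₂)) (I₂ := 𝓘(ℝ, E₃)) x z‖ ^ 2 = 1 := by
    rw [← real_inner_self_eq_norm_sq, ← hM.immersion.isometry, hξ, ← S.η_eq, S.η_ξ]
  rw [h1, h2, h3]
  simp

end IsWarpedSkewCR

end SkewCR

end KenmotsuSkewCR

end

open KenmotsuSkewCR in
theorem theorem6p2
    {E : Type*} [NormedAddCommGroup E] [NormedSpace ℝ E] [FiniteDimensional ℝ E]
    {N : Type*} [TopologicalSpace N] [ChartedSpace E N] [IsManifold 𝓘(ℝ, E) ∞ N]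
    [RiemannianBundle (fun y : N ↦ TangentSpace 𝓘(ℝ, E) y)]
    [IsContMDiffRiemannianBundle 𝓘(ℝ, E) ∞ E (fun y : N ↦ TangentSpace 𝓘(ℝ, E) y)]
    (S : AlmostContactMetric 𝓘(ℝ, E) N)
    (D : CovariantDerivative 𝓘(ℝ, E) E (TangentSpace 𝓘(ℝ, E) : N → Type _))
    (hS : IsKenmotsu S D)
    {E₁ : Type*} [NormedAddCommGroup E₁] [NormedSpace ℝ E₁] [FiniteDimensional ℝ E₁]
    {A : Type*} [TopologicalSpace A] [ChartedSpace E₁ A] [IsManifold 𝓘(ℝ, E₁) ∞ A]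
    {E₂ : Type*} [NormedAddCommGroup E₂] [NormedSpace ℝ E₂] [FiniteDimensional ℝ E₂]
    {B : Type*} [TopologicalSpace B] [ChartedSpace E₂ B] [IsManifold 𝓘(ℝ, E₂) ∞ B]
    {E₃ : Type*} [NormedAddCommGroup E₃] [NormedSpace ℝ E₃] [FiniteDimensional ℝ E₃]
    {C : Type*} [TopologicalSpace C] [ChartedSpace E₃ C] [IsManifold 𝓘(ℝ, E₃) ∞ C]
    [RiemannianBundle (fun x : (A × B) × C ↦ TangentSpace (model₃ E₁ E₂ E₃) x)]
    (F : (A × B) × C → N) (f : A × B → ℝ) (θ : ℝ)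
    (hM : IsWarpedSkewCR E₁ E₂ E₃ S F f θ)
    (p : ℕ) (hp : Module.finrank ℝ E₃ = 2 * p) :
    (∀ x : (A × B) × C,
      2 * (p : ℝ) * (‖gradLogPerp E₁ E₂ E₃ f x‖ ^ 2 - 1 +
          (1 / Real.sin θ ^ 2 + Real.cot θ ^ 2) * ‖gradLogSlant E₁ E₂ E₃ f x‖ ^ 2) ≤ sffNormSq (model₃ E₁ E₂ E₃) D F x) ∧
    ((∀ x : (A × B) × C,
      sffNormSq (model₃ E₁ E₂ E₃) D F x = 2 * (p : ℝ) * (‖gradLogPerp E₁ E₂ E₃ f x‖ ^ 2 - 1 +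
          (1 / Real.sin θ ^ 2 + Real.cot θ ^ 2) * ‖gradLogSlant E₁ E₂ E₃ f x‖ ^ 2)) →
      IsTotallyGeodesic (model₃ E₁ E₂ E₃) D F ∧
      ∀ m : A × B, IsTotallyUmbilical 𝓘(ℝ, E₃) D (fun c : C ↦ F (m, c))) := by
  refine ⟨fun x ↦ ?_, fun h ↦ ?_⟩
  -- The left side is zero, so only `0 ≤ ‖h‖²` is left; likewise equality below forces `‖h‖² = 0`.
  · rw [hM.bound_eq_zero hS hp]
    exact sffNormSq_nonneg
  have hg : IsTotallyGeodesic (model₃ E₁ E₂ E₃) D F := fun x u v ↦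
    sff_eq_zero_of_sffNormSq_eq_zero hM.immersion.smooth
      ((h x).trans (hM.bound_eq_zero hS hp _ x)) u v
  exact ⟨hg, isTotallyUmbilical_leaf hS hM.immersion hM.warped hM.exists_φ_vertical
    (fun y ↦ (hM.exists_mfderiv_horizontal y).imp fun _ hz ↦ hz.2) hM.η_vertical hg⟩
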